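/- There are absolute constants $C'>0$ and $c\in\mathbb{N}$ and a randomized one-pass streaming algorithm such that the following holds. Let $k,n,m$ be natural numbers and $\varepsilon\in(0,1]$ (all known to the algorithm) with $$ n\;\ge\; C'\cdot\max\left(\frac{k\sqrt{\log n}}{\varepsilon^2\sqrt m},\ \frac{k^{2/3}}{\varepsilon^{4/3}}\right),\qquad \max(\log k,\ \log(1/\varepsilon))\;\le\; m\;\le\; k\log n, $$ where $\log$ is to base $2$. Then the algorithm, using at most $c\cdot m$ bits of memory, performs closeness testing over $[k]=\{1,\dots,k\}$ with distance parameter $\varepsilon$ from $n$ samples of each of two unknown distributions. That is, for all probability distributions $p,q$ over $[k]$, when it reads once $n$ independent samples from $p$ and $n$ independent samples from $q$ (each labelled by the stream it comes from, the two streams being interleaved in any fixed order, not known to the algorithm in advance), then at the end of the stream - if $p=q$, it outputs accept with probability at least $2/3$; - if $d_{TV}(p,q)=\frac12\sum_{i=1}^k|p(i)-q(i)|>\varepsilon$, it outputs reject with probability at least $2/3$. Here an algorithm with $b$ bits of memory keeps between two samples nothing but one of $2^b$ memory contents: the initial content is random, each new content is drawn with fresh coins from a distribution that depends only on the current content and the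 sample just read (there is no free clock), and the output is a function of the final content. -/

import Mathlib

/-- A randomized one-pass streaming algorithm for two labelled streams over `Fin k`, whose memory
consists of `b` bits.

The memory content is all that is kept between two samples.  In particular there is no external
clock, and random choices that are to be used again later have to be stored in the memory: `init`
and `step` use fresh private coins.  A sample arrives as a pair `(s, x)`, where `x` is the observed
element and `s` tells which of the two streams it belongs to (`true` is the first stream, `false`
the second). -/
structure StreamAlg (k b : ℕ) where
  /-- (random) initial memory content -/
  init : PMF (Fin b → Bool)
  /-- (random) new memory content, from the current one and the sample just read -/
  step : (Fin b → Bool) → Bool × Fin k → PMF (Fin b → Bool)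
  /-- verdict at the end of the stream: `true` is accept, `false` is reject -/
  output : (Fin b → Bool) → Bool

namespace StreamAlg

/-- Law of the memory content after reading the given list of samples once, starting from memory
content `s`. -/
noncomputable def runFrom {k b : ℕ} (A : StreamAlg k b) :
    List (Bool × Fin k) → (Fin b → Bool) → PMF (Fin b → Bool)
  | [], s => PMF.pure s
  | x :: xs, s => (A.step s x).bind (A.runFrom xs)

/-- Law of the verdict on a given list of samples. -/
noncomputable def verdict {k b : ℕ} (A : StreamAlg k b) (xs : List (Bool × Fin k)) : PMF Bool :=
  (A.init.bind (A.runFrom xs)).map A.output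

end StreamAlg

/-- Law of the labelled samples when the streams are read in the order `σ`: the samples are
independent, those labelled `true` are drawn from `p` and those labelled `false` from `q`. -/
noncomputable def sampleLaw {k : ℕ} (p q : PMF (Fin k)) : List Bool → PMF (List (Bool × Fin k))
  | [] => PMF.pure []
  | s :: σ => (if s then p else q).bind fun x => (sampleLaw p q σ).map fun xs => (s, x) :: xs

/-- Law of the verdict on independent samples from `p` and `q`, read in the order `σ`; it accounts
for the samples and for the coins of the algorithm. -/
noncomputable def StreamAlg.verdictLaw {k b : ℕ} (A : StreamAlg k b) (p q : PMF (Fin k))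
    (σ : List Bool) : PMF Bool :=
  (sampleLaw p q σ).bind A.verdict

/-- Total variation distance of two distributions over `Fin k`. -/
noncomputable def tvDist {k : ℕ} (p q : PMF (Fin k)) : ℝ :=
  (1 / 2) * ∑ i, |(p i).toReal - (q i).toReal|

/-- `A` tests closeness with distance parameter `ε` from `n` samples of each of the two unknown
distributions, in whichever order the two streams are interleaved. -/
def StreamAlg.TestsCloseness {k b : ℕ} (A : StreamAlg k b) (n : ℕ) (ε : ℝ) : Prop :=
  ∀ p q : PMF (Fin k), ∀ σ : List Bool, σ.count true = n → σ.count false = n →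
    (p = q → 2 / 3 ≤ (A.verdictLaw p q σ true).toReal) ∧
    (ε < tvDist p q → 2 / 3 ≤ (A.verdictLaw p q σ false).toReal)

/-!
A tester that keeps a short record of samples, a hash function and two small vectors of counters.

The first `s` samples are recorded, whatever their streams.  An element `i` with `c i` records gets
the weight `a i = 1 + c i`; recorded elements get counters of their own, all other elements are
hashed into `2 ^ e` buckets of weight one.  Of the following samples, `N` of each stream enter a
first sketch `U`, the vector over the buckets of the differences between the numbers of samples from
`p` and from `q`, and the next `N` of each stream enter a second sketch `V`.  The tester accepts if
the statistic `∑ j, U j * V j / a j` is small.  Since `U` and `V` are independent, the statistic has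
mean `N ^ 2 * Δ`, where `Δ = ∑ j, (p' j - q' j) ^ 2 / a j` for the laws `p'`, `q'` of the buckets,
and no correction for samples that are compared with themselves is needed.

* Variance (`sampleMean_statistic_sub_sq_le`).  It is governed by `∑ j, (p' j + q' j) ^ 2 / a j ^ 2`.
  It is enough to control the contribution of one of the two laws, because the other one differs
  from it by `p' - q'`, which is dominated by the mean `N ^ 2 * Δ`.  Hence it does no harm that the
  record may consist of samples of one stream only.
* Flattening (`sampleMean_sum_sq_div_count_le`).  The stream that provides at least half of the
  record has `∑ i, p i ^ 2 / a i ^ 2 ≤ 4 / s` on average: the potential `1 / (1 + c i)` starts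
  at `1`, decreases, and pays for the sum.
* Distance (`sq_sum_abs_div_le`).  By the Cauchy-Schwarz inequality,
  `∑ i, (p i - q i) ^ 2 / a i ≥ (∑ i, |p i - q i|) ^ 2 / (k + s)`, which is at least of order
  `ε ^ 2 / k` when `s ≤ k`.
* Hashing (`sum_collisionSum_sub_sq_le`).  The hash function is a random cubic polynomial over a field
  of characteristic two followed by a projection, so that it has a short seed and collisions of
  different pairs are uncorrelated.  By Chebyshev's inequality collisions seldom halve `Δ`, and on
  average they increase the squared norm of a law by at most `2 ^ (-e)`.

Together, the tester works as soon as `s ≤ k`, `s ≤ 2 ^ e` and `N ^ 2 * ε ^ 4 * s ≥ K * k ^ 2` for a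
constant `K` (`exists_testsCloseness`).  With `N` of order `n` and `s` the least of `k`, `n / 4` and
about `m / log n`, this is what the hypotheses on `n` and `m` say, and the memory is of order
`(s + 2 ^ e) * log n`, hence of order `m`.  If `n` is so large that `log n` exceeds `15 * m`, only
the beginning of each stream is used.

Probabilities are handled as finite sums, through the operator `sampleMean`, defined by recursion
over the list of labels.
-/

/-! ### Expectation over independent labelled samples -/

/-- Expectation of `F` over a list of independent labelled samples, the labels being given by the
list `σ` and a sample with label `s` having the weights `P s`.  It is defined by recursion, as a
finite sum over one sample after the other. -/
noncomputable def sampleMean {α : Type*} [Fintype α] (P : Bool → α → ℝ) :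
    List Bool → (List (Bool × α) → ℝ) → ℝ
  | [], F => F []
  | s :: σ, F => ∑ x, P s x * sampleMean P σ fun xs => F ((s, x) :: xs)

section sampleMean

variable {α : Type*} [Fintype α] {P : Bool → α → ℝ}

theorem sampleMean_add (σ : List Bool) (F G : List (Bool × α) → ℝ) :
    sampleMean P σ (fun xs => F xs + G xs) = sampleMean P σ F + sampleMean P σ G := by
  induction σ generalizing F G with
  | nil => rfl
  | cons s σ ih => simp only [sampleMean, ih, mul_add, Finset.sum_add_distrib]

theorem sampleMean_const_mul (σ : List Bool) (c : ℝ) (F : List (Bool × α) → ℝ) :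
    sampleMean P σ (fun xs => c * F xs) = c * sampleMean P σ F := by
  induction σ generalizing F with
  | nil => rfl
  | cons s σ ih =>
    simp only [sampleMean, ih, Finset.mul_sum]
    exact Finset.sum_congr rfl fun x _ => by ring

theorem sampleMean_zero (σ : List Bool) : sampleMean P σ (fun _ => 0) = 0 := by
  simpa using sampleMean_const_mul (P := P) σ 0 fun _ => 0

theorem sampleMean_sum {ι : Type*} (S : Finset ι) (σ : List Bool)
    (F : ι → List (Bool × α) → ℝ) :
    sampleMean P σ (fun xs => ∑ i ∈ S, F i xs) = ∑ i ∈ S, sampleMean P σ (F i) := by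
  classical
  induction S using Finset.induction_on with
  | empty => simp [sampleMean_zero]
  | insert a S ha ih => simp only [Finset.sum_insert ha, sampleMean_add, ih]

theorem sampleMean_const (h1 : ∀ s, ∑ x, P s x = 1) (σ : List Bool) (c : ℝ) :
    sampleMean P σ (fun _ => c) = c := by
  induction σ with
  | nil => rfl
  | cons s σ ih => simp only [sampleMean, ih, ← Finset.sum_mul, h1, one_mul]

/-- Only lists with the prescribed labels matter for the monotonicity. -/
theorem sampleMean_mono_of_map (h0 : ∀ s x, 0 ≤ P s x) (σ : List Bool)
    {F G : List (Bool × α) → ℝ} (h : ∀ xs, xs.map Prod.fst = σ → F xs ≤ G xs) :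
    sampleMean P σ F ≤ sampleMean P σ G := by
  induction σ generalizing F G with
  | nil => exact h [] rfl
  | cons s σ ih =>
    exact Finset.sum_le_sum fun x _ => mul_le_mul_of_nonneg_left
      (ih fun xs hxs => h _ (by simp [hxs])) (h0 s x)

theorem sampleMean_mono (h0 : ∀ s x, 0 ≤ P s x) (σ : List Bool)
    {F G : List (Bool × α) → ℝ} (h : ∀ xs, F xs ≤ G xs) :
    sampleMean P σ F ≤ sampleMean P σ G :=
  sampleMean_mono_of_map h0 σ fun xs _ => h xs

theorem sampleMean_congr (σ : List Bool) {F G : List (Bool × α) → ℝ}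
    (h : ∀ xs, xs.map Prod.fst = σ → F xs = G xs) :
    sampleMean P σ F = sampleMean P σ G := by
  induction σ generalizing F G with
  | nil => exact h [] rfl
  | cons s σ ih =>
    exact Finset.sum_congr rfl fun x _ => by rw [ih fun xs hxs => h _ (by simp [hxs])]

theorem sampleMean_append (σ₁ σ₂ : List Bool) (F : List (Bool × α) → ℝ) :
    sampleMean P (σ₁ ++ σ₂) F =
      sampleMean P σ₁ fun xs => sampleMean P σ₂ fun ys => F (xs ++ ys) := by
  induction σ₁ generalizing F with
  | nil => rfl
  | cons s σ ih => simp only [List.cons_append, sampleMean, ih]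

/-- A sum of one function per sample has the mean that linearity of expectation predicts. -/
theorem sampleMean_linear (h1 : ∀ s, ∑ x, P s x = 1) (f : Bool × α → ℝ) (σ : List Bool) (z : ℝ) :
    sampleMean P σ (fun xs => z + (xs.map f).sum) =
      z + (σ.map fun s => ∑ x, P s x * f (s, x)).sum := by
  induction σ generalizing z with
  | nil => simp [sampleMean]
  | cons s σ ih =>
    simp only [sampleMean, List.map_cons, List.sum_cons, ← add_assoc, ih]
    simp only [mul_add, Finset.sum_add_distrib, ← Finset.sum_mul, h1]
    ring

/-- Second moment of a sum of one function per sample: the variances, which add up by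
independence, are at most the second moments of the summands. -/
theorem sampleMean_sq_le (h1 : ∀ s, ∑ x, P s x = 1) (h0 : ∀ s x, 0 ≤ P s x)
    (f : Bool × α → ℝ) (σ : List Bool) (z : ℝ) :
    sampleMean P σ (fun xs => (z + (xs.map f).sum) ^ 2) ≤
      (z + (σ.map fun s => ∑ x, P s x * f (s, x)).sum) ^ 2 +
        (σ.map fun s => ∑ x, P s x * f (s, x) ^ 2).sum := by
  induction σ generalizing z with
  | nil => simp [sampleMean]
  | cons s σ ih =>
    simp only [sampleMean, List.map_cons, List.sum_cons, ← add_assoc]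
    refine (Finset.sum_le_sum fun x _ => mul_le_mul_of_nonneg_left (ih (z + f (s, x)))
      (h0 s x)).trans ?_
    set y := (σ.map fun s => ∑ x, P s x * f (s, x)).sum
    set v := (σ.map fun s => ∑ x, P s x * f (s, x) ^ 2).sum
    have e : ∑ x, P s x * ((z + f (s, x) + y) ^ 2 + v) =
        ((z + y) ^ 2 + v) * ∑ x, P s x + 2 * (z + y) * (∑ x, P s x * f (s, x)) +
          ∑ x, P s x * f (s, x) ^ 2 := by
      simp only [Finset.mul_sum, ← Finset.sum_add_distrib]
      exact Finset.sum_congr rfl fun x _ => by ring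
    rw [e, h1]
    nlinarith [sq_nonneg (∑ x, P s x * f (s, x))]

end sampleMean

/-- A sum over a list of labels depends only on how often each label occurs. -/
theorem sum_map_bool (l : List Bool) (f : Bool → ℝ) :
    (l.map f).sum = l.count true * f true + l.count false * f false := by
  induction l with
  | nil => simp
  | cons b l ih => cases b <;> simp [ih] <;> ring

/-! ### Deterministic machines with a random seed -/

/-- The law of the samples, followed by any random experiment on them, in terms of `sampleMean`. -/
theorem toReal_sampleLaw_bind {k : ℕ} (p q : PMF (Fin k)) {β : Type*} (σ : List Bool)
    (f : List (Bool × Fin k) → PMF β) (b : β) :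
    (((sampleLaw p q σ).bind f) b).toReal =
      sampleMean (fun s x => ((if s then p else q) x).toReal) σ fun xs => (f xs b).toReal := by
  induction σ generalizing f with
  | nil => simp [sampleLaw, sampleMean]
  | cons s σ ih =>
    simp only [sampleLaw, sampleMean, PMF.bind_bind, PMF.bind_map]
    rw [PMF.bind_apply, tsum_fintype, ENNReal.toReal_sum
      fun x _ => ENNReal.mul_ne_top (PMF.apply_ne_top _ _) (PMF.apply_ne_top _ _)]
    refine Finset.sum_congr rfl fun x _ => ?_
    rw [ENNReal.toReal_mul]
    congr 1
    exact ih (fun xs => f ((s, x) :: xs))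

theorem toReal_verdictLaw {k b : ℕ} (A : StreamAlg k b) (p q : PMF (Fin k)) (σ : List Bool)
    (v : Bool) :
    (A.verdictLaw p q σ v).toReal =
      sampleMean (fun s x => ((if s then p else q) x).toReal) σ
        fun xs => (A.verdict xs v).toReal :=
  toReal_sampleLaw_bind p q σ A.verdict v

theorem sum_toReal_eq_one {k : ℕ} (p : PMF (Fin k)) : ∑ x, (p x).toReal = 1 := by
  rw [← ENNReal.toReal_sum fun x _ => PMF.apply_ne_top _ _, ← tsum_fintype (L := .unconditional _),
    p.tsum_coe, ENNReal.toReal_one]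

/-- A deterministic machine with a uniformly random seed is a streaming algorithm with `b` bits of
memory as soon as the states that satisfy some invariant can be told apart by an encoding into a
type of at most `2 ^ b` elements. -/
theorem exists_streamAlg_of_machine {k b : ℕ} {S Ω T : Type*} [Fintype Ω] [Nonempty Ω] [Fintype T]
    (step : S → Bool × Fin k → S) (init : Ω → S) (out : S → Bool) (Inv : S → Prop)
    (hinit : ∀ ω, Inv (init ω)) (hstep : ∀ s x, Inv s → Inv (step s x))
    (enc : S → T) (henc : Set.InjOn enc {s | Inv s}) (hT : Fintype.card T ≤ 2 ^ b) :
    ∃ A : StreamAlg k b, ∀ xs v, (A.verdict xs v).toReal =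
      (∑ ω, if out (xs.foldl step (init ω)) = v then 1 else 0) / Fintype.card Ω := by
  classical
  have hS : Nonempty S := ⟨init (Classical.arbitrary Ω)⟩
  obtain ⟨emb⟩ : Nonempty (T ↪ (Fin b → Bool)) :=
    Function.Embedding.nonempty_of_card_le (by simpa using hT)
  let code : S → Fin b → Bool := fun s => emb (enc s)
  have hcode : Set.InjOn code {s | Inv s} := fun s hs t ht h => henc hs ht (emb.injective h)
  let dec : (Fin b → Bool) → S := Function.invFunOn code {s | Inv s}
  have hdec : ∀ s, Inv s → dec (code s) = s := fun s hs => hcode.leftInvOn_invFunOn hs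
  have hfold : ∀ (xs : List (Bool × Fin k)) s, Inv s → Inv (xs.foldl step s) := by
    intro xs
    induction xs with
    | nil => exact fun s hs => hs
    | cons x xs ih => exact fun s hs => ih _ (hstep s x hs)
  let A : StreamAlg k b :=
    { init := (PMF.uniformOfFintype Ω).map fun ω => code (init ω)
      step := fun c x => PMF.pure (code (step (dec c) x))
      output := fun c => out (dec c) }
  have hrun : ∀ xs s, Inv s → A.runFrom xs (code s) = PMF.pure (code (xs.foldl step s)) := by
    intro xs
    induction xs with
    | nil => intro s _; rfl
    | cons x xs ih =>
      intro s hs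
      simp only [StreamAlg.runFrom, A, PMF.pure_bind, hdec s hs, List.foldl_cons]
      exact ih _ (hstep s x hs)
  refine ⟨A, fun xs v => ?_⟩
  have hv : A.verdict xs =
      (PMF.uniformOfFintype Ω).map fun ω => out (xs.foldl step (init ω)) := by
    unfold StreamAlg.verdict
    simp only [show A.init = (PMF.uniformOfFintype Ω).map fun ω => code (init ω) from rfl,
      PMF.bind_map]
    rw [PMF.map_bind, PMF.map]
    congr 1
    funext ω
    simp only [Function.comp, hrun _ _ (hinit ω), PMF.pure_map, A, hdec _ (hfold xs _ (hinit ω))]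
  rw [hv, PMF.map_apply, tsum_fintype, ENNReal.toReal_sum]
  · rw [Finset.sum_div]
    refine Finset.sum_congr rfl fun ω _ => ?_
    rw [PMF.uniformOfFintype_apply]
    by_cases h : out (xs.foldl step (init ω)) = v
    · simp [h]
    · simp [h, Ne.symm h]
  · intro ω _
    split_ifs <;> simp

/-! ### Hashing with independent pairwise collisions -/

/-- The family `h` of functions, with a uniformly random index `ω`, has collisions as rare as those
of a random function, and collisions of distinct unordered pairs are pairwise independent. -/
structure IsPairHash {Ω κ B : Type*} [Fintype Ω] [Fintype B] [DecidableEq B] (h : Ω → κ → B) :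
    Prop where
  /-- A pair of distinct points collides with probability `1 / |B|`. -/
  collision : ∀ i j, i ≠ j →
    (∑ ω, if h ω i = h ω j then (1 : ℝ) else 0) = Fintype.card Ω / Fintype.card B
  /-- Two different pairs of distinct points both collide with probability `1 / |B| ^ 2`. -/
  collision_collision : ∀ i j i' j', i ≠ j → i' ≠ j' → ¬(i = i' ∧ j = j') → ¬(i = j' ∧ j = i') →
    (∑ ω, (if h ω i = h ω j then (1 : ℝ) else 0) * (if h ω i' = h ω j' then 1 else 0)) =
      Fintype.card Ω / (Fintype.card B : ℝ) ^ 2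

/-- The kernel of a surjective homomorphism of finite groups has `|G| / |H|` elements. -/
theorem sum_ite_eq_zero_of_surjective {G H : Type*} [AddGroup G] [AddGroup H] [Fintype G]
    [Fintype H] [DecidableEq H] (φ : G →+ H) (hφ : Function.Surjective φ) :
    (∑ g, if φ g = 0 then (1 : ℝ) else 0) = Fintype.card G / Fintype.card H := by
  have hH : (Fintype.card H : ℝ) ≠ 0 := by
    have : 0 < Fintype.card H := Fintype.card_pos
    positivity
  rw [eq_div_iff hH, Finset.sum_boole]
  have h1 := AddSubgroup.card_eq_card_quotient_mul_card_addSubgroup φ.ker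
  rw [Nat.card_congr (QuotientAddGroup.quotientKerEquivOfSurjective φ hφ).toEquiv,
    Nat.card_eq_fintype_card, Nat.card_eq_fintype_card, Nat.card_eq_fintype_card (α := φ.ker)] at h1
  have h2 : Fintype.card φ.ker = (Finset.univ.filter fun g => φ g = 0).card :=
    Fintype.card_of_subtype _ fun g => by simp [AddMonoidHom.mem_ker]
  rw [h1, ← h2]
  push_cast
  ring

section Cubic

variable {F : Type*} [Field F]

/-- The value at `x` of the polynomial of degree at most three with coefficients `a`, as a
homomorphism in `a`. -/
def cubicEval (x : F) : (Fin 4 → F) →+ F where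
  toFun a := ∑ l, a l * x ^ (l : ℕ)
  map_zero' := by simp
  map_add' a b := by simp [add_mul, Finset.sum_add_distrib]

theorem exists_cubicEval_eq [DecidableEq F] (S : Finset F) (hS : S.card ≤ 4) (v : F → F) :
    ∃ a, ∀ x ∈ S, cubicEval x a = v x := by
  have hinj : Set.InjOn (id : F → F) S := Function.injective_id.injOn
  refine ⟨fun l => (Lagrange.interpolate S id v).coeff l, fun x hx => ?_⟩
  have hd : (Lagrange.interpolate S id v).degree < (4 : ℕ) :=
    (Lagrange.degree_interpolate_lt v hinj).trans_le (by exact_mod_cast hS)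
  have hev := Lagrange.eval_interpolate_at_node v hinj hx
  have hnd : (Lagrange.interpolate S id v).natDegree < 4 := by
    by_cases h0 : Lagrange.interpolate S id v = 0
    · simp [h0]
    · exact (Polynomial.natDegree_lt_iff_degree_lt h0).2 hd
  rw [Polynomial.eval_eq_sum_range' hnd, Finset.sum_range] at hev
  exact hev

/-- The differences of values at two different pairs of points are independent. -/
theorem exists_cubicEval_sub_eq {i j i' j' : F} (hij : i ≠ j) (hij' : i' ≠ j')
    (h1 : ¬(i = i' ∧ j = j')) (h2 : ¬(i = j' ∧ j = i')) (α β : F) :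
    ∃ a, cubicEval i a - cubicEval j a = α ∧ cubicEval i' a - cubicEval j' a = β := by
  classical
  obtain ⟨v, hv1, hv2⟩ : ∃ v : F → F, v i - v j = α ∧ v i' - v j' = β := by
    by_cases hi : i' = i ∨ i' = j
    · -- then `j'` lies outside the first pair, and its value is free
      have hj1 : j' ≠ i := by rintro rfl; grind
      have hj2 : j' ≠ j := by rintro rfl; grind
      refine ⟨fun x => if x = i then α else if x = j' then (if i' = i then α else 0) - β else 0,
        ?_, ?_⟩ <;> grind
    · refine ⟨fun x => if x = i then α else if x = i' then (if j' = i then α else 0) + β else 0,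
        ?_, ?_⟩ <;> grind
  obtain ⟨a, ha⟩ := exists_cubicEval_eq {i, j, i', j'} Finset.card_le_four v
  exact ⟨a, by rw [ha i (by simp), ha j (by simp), hv1], by
    rw [ha i' (by simp), ha j' (by simp), hv2]⟩

/-- A random cubic polynomial over a field, composed with a surjective homomorphism onto a smaller
group, has independent pairwise collisions. -/
theorem isPairHash_cubicEval [Fintype F] {B κ : Type*} [AddCommGroup B] [Fintype B]
    [DecidableEq B] (ι : κ → F) (hι : Function.Injective ι) (π : F →+ B)
    (hπ : Function.Surjective π) :
    IsPairHash fun (a : Fin 4 → F) (x : κ) => π (cubicEval (ι x) a) := by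
  classical
  let δ : κ → κ → (Fin 4 → F) →+ F := fun i j => cubicEval (ι i) - cubicEval (ι j)
  have hδ : ∀ i j a, π (cubicEval (ι i) a) = π (cubicEval (ι j) a) ↔ π (δ i j a) = 0 := by
    intro i j a
    rw [show δ i j a = cubicEval (ι i) a - cubicEval (ι j) a from rfl, map_sub, sub_eq_zero]
  refine ⟨fun i j hij => ?_, fun i j i' j' hij hij' h1 h2 => ?_⟩
  · simp only [hδ]
    refine sum_ite_eq_zero_of_surjective (π.comp (δ i j)) fun b => ?_
    obtain ⟨y, rfl⟩ := hπ b
    obtain ⟨a, ha⟩ := exists_cubicEval_eq {ι i, ι j}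
      (Finset.card_le_two.trans (by norm_num)) fun x => if x = ι i then y else 0
    refine ⟨a, ?_⟩
    have hne : ι j ≠ ι i := fun h => hij (hι h).symm
    show π (cubicEval (ι i) a - cubicEval (ι j) a) = π y
    rw [ha _ (by simp), ha _ (by simp)]
    simp [hne]
  · have h := sum_ite_eq_zero_of_surjective
      ((π.comp (δ i j)).prod (π.comp (δ i' j'))) fun b => by
        obtain ⟨y, hy⟩ := hπ b.1
        obtain ⟨z, hz⟩ := hπ b.2
        obtain ⟨a, ha1, ha2⟩ := exists_cubicEval_sub_eq (hι.ne hij) (hι.ne hij')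
          (fun h => h1 ⟨hι h.1, hι h.2⟩) (fun h => h2 ⟨hι h.1, hι h.2⟩) y z
        exact ⟨a, Prod.ext ((congrArg π ha1).trans hy) ((congrArg π ha2).trans hz)⟩
    rw [Fintype.card_prod] at h
    push_cast at h
    rw [sq, ← h]
    refine Finset.sum_congr rfl fun a _ => ?_
    simp only [hδ, AddMonoidHom.prod_apply, Prod.mk_eq_zero, AddMonoidHom.comp_apply,
      ite_and, ite_mul, one_mul, zero_mul]

end Cubic

/-- Hashing `k` points into `2 ^ e` buckets with a seed of `4 * t` bits. -/
theorem exists_isPairHash {k e t : ℕ} (hk : k ≤ 2 ^ t) (he : e ≤ t) (ht : t ≠ 0) :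
    ∃ (Ω : Type) (_ : Fintype Ω) (_ : Nonempty Ω) (h : Ω → Fin k → Fin e → ZMod 2),
      Fintype.card Ω = 2 ^ (4 * t) ∧ IsPairHash h := by
  classical
  let F := GaloisField 2 t
  let _ : Fintype F := Fintype.ofFinite F
  have hF : Fintype.card F = 2 ^ t := by
    rw [← Nat.card_eq_fintype_card]; exact GaloisField.card 2 t ht
  obtain ⟨ι⟩ : Nonempty (Fin k ↪ F) :=
    Function.Embedding.nonempty_of_card_le (by simpa [hF] using hk)
  let b : F ≃ₗ[ZMod 2] (Fin t → ZMod 2) :=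
    LinearEquiv.ofFinrankEq _ _ (by rw [GaloisField.finrank 2 ht]; simp)
  let π : F →+ (Fin e → ZMod 2) :=
    ((LinearMap.funLeft (ZMod 2) (ZMod 2) (Fin.castLE he)).comp b.toLinearMap).toAddMonoidHom
  have hπ : Function.Surjective π :=
    (LinearMap.funLeft_surjective_of_injective (ZMod 2) (ZMod 2) _
      (Fin.castLE_injective he)).comp b.surjective
  refine ⟨Fin 4 → F, inferInstance, inferInstance, _, ?_,
    isPairHash_cubicEval ι ι.injective π hπ⟩
  rw [Fintype.card_fun, hF, Fintype.card_fin, ← pow_mul, mul_comm]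

/-! ### Moments of the bilinear statistic -/

section Sketch

variable {α D : Type*} [DecidableEq D]

/-- The sign `1` or `-1` with which a sample of the given stream is counted. -/
def streamSign (s : Bool) : ℤ := if s then 1 else -1

/-- The vector of differences, bucket by bucket, between the numbers of samples from the first and
from the second stream, when `g` assigns a bucket to each element. -/
def sketch (g : α → D) (xs : List (Bool × α)) (j : D) : ℤ :=
  (xs.map fun y => if g y.2 = j then streamSign y.1 else 0).sum

theorem sum_mul_sketch [Fintype D] (g : α → D) (c : D → ℝ) (xs : List (Bool × α)) :
    ∑ j, c j * (sketch g xs j : ℝ) =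
      (xs.map fun y => (streamSign y.1 : ℝ) * c (g y.2)).sum := by
  induction xs with
  | nil => simp [sketch]
  | cons y xs ih =>
    rw [List.map_cons, List.sum_cons, ← ih]
    simp only [sketch, List.map_cons, List.sum_cons, Int.cast_add, mul_add,
      Finset.sum_add_distrib]
    congr 1
    simp [mul_comm]

variable [Fintype α]

/-- The total weight `f` of the elements in the bucket `j`. -/
noncomputable def bucketMass (f : α → ℝ) (g : α → D) (j : D) : ℝ :=
  ∑ x, if g x = j then f x else 0

theorem bucketMass_nonneg {f : α → ℝ} (h0 : ∀ x, 0 ≤ f x) (g : α → D) (j : D) :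
    0 ≤ bucketMass f g j :=
  Finset.sum_nonneg fun x _ => by split_ifs <;> simp [h0]

variable {P : Bool → α → ℝ}

variable [Fintype D]

/-- The weighted inner product of two sketches. -/
noncomputable def statistic (a : D → ℝ) (u v : D → ℤ) : ℝ := ∑ j, (u j : ℝ) * v j / a j

theorem sum_bucketMass_mul (f : α → ℝ) (g : α → D) (c : D → ℝ) :
    ∑ j, bucketMass f g j * c j = ∑ x, f x * c (g x) := by
  simp only [bucketMass, Finset.sum_mul, ite_mul, zero_mul]
  rw [Finset.sum_comm]
  simp

variable {N : ℕ} {σ : List Bool}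

theorem sampleMean_linear_sketch (h1 : ∀ s, ∑ x, P s x = 1) (ht : σ.count true = N)
    (hf : σ.count false = N) (g : α → D) (c : D → ℝ) :
    sampleMean P σ (fun xs => ∑ j, c j * (sketch g xs j : ℝ)) =
      N * ∑ j, (bucketMass (P true) g j - bucketMass (P false) g j) * c j := by
  have h := sampleMean_linear h1 (fun y : Bool × α => (streamSign y.1 : ℝ) * c (g y.2)) σ 0
  simp only [zero_add] at h
  simp only [sum_mul_sketch, h, sum_map_bool, ht, hf, sub_mul, Finset.sum_sub_distrib,
    sum_bucketMass_mul]
  simp [streamSign]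
  ring

theorem sampleMean_sq_linear_sketch_le (h1 : ∀ s, ∑ x, P s x = 1) (h0 : ∀ s x, 0 ≤ P s x)
    (ht : σ.count true = N) (hf : σ.count false = N) (g : α → D) (c : D → ℝ) :
    sampleMean P σ (fun xs => (∑ j, c j * (sketch g xs j : ℝ)) ^ 2) ≤
      (N * ∑ j, (bucketMass (P true) g j - bucketMass (P false) g j) * c j) ^ 2 +
        N * ∑ j, (bucketMass (P true) g j + bucketMass (P false) g j) * c j ^ 2 := by
  have h := sampleMean_sq_le h1 h0 (fun y : Bool × α => (streamSign y.1 : ℝ) * c (g y.2)) σ 0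
  simp only [zero_add] at h
  simp only [sum_mul_sketch]
  refine h.trans (le_of_eq ?_)
  simp only [sum_map_bool, ht, hf, sub_mul, add_mul, Finset.sum_sub_distrib,
    Finset.sum_add_distrib, sum_bucketMass_mul _ _ c, sum_bucketMass_mul _ _ fun j => c j ^ 2]
  simp [streamSign]
  ring

/-- Mean of the statistic: the two sketches are independent with means `N * (p' - q')`. -/
theorem sampleMean_statistic (h1 : ∀ s, ∑ x, P s x = 1) {τ : List Bool}
    (ht : σ.count true = N) (hf : σ.count false = N) (ht' : τ.count true = N)
    (hf' : τ.count false = N) (g : α → D) (a : D → ℝ) :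
    sampleMean P σ (fun xs => sampleMean P τ fun ys =>
        statistic a (sketch g xs) (sketch g ys)) =
      N ^ 2 * ∑ j, (bucketMass (P true) g j - bucketMass (P false) g j) ^ 2 / a j := by
  have e : ∀ xs ys : List (Bool × α), statistic a (sketch g xs) (sketch g ys) =
      ∑ j, ((sketch g xs j : ℝ) / a j) * (sketch g ys j : ℝ) := fun xs ys =>
    Finset.sum_congr rfl fun j _ => by ring
  simp only [e, sampleMean_linear_sketch h1 ht' hf']
  rw [sampleMean_const_mul]
  have e2 : ∀ xs : List (Bool × α),
      ∑ j, (bucketMass (P true) g j - bucketMass (P false) g j) * ((sketch g xs j : ℝ) / a j) =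
      ∑ j, ((bucketMass (P true) g j - bucketMass (P false) g j) / a j) * (sketch g xs j : ℝ) :=
    fun xs => Finset.sum_congr rfl fun j _ => by ring
  simp only [e2, sampleMean_linear_sketch h1 ht hf]
  rw [← mul_assoc, ← sq]
  congr 1
  exact Finset.sum_congr rfl fun j _ => by ring

/-- Second moment of the statistic. -/
theorem sampleMean_statistic_sq_le (h1 : ∀ s, ∑ x, P s x = 1) (h0 : ∀ s x, 0 ≤ P s x)
    {τ : List Bool} (ht : σ.count true = N) (hf : σ.count false = N) (ht' : τ.count true = N)
    (hf' : τ.count false = N) (g : α → D) (a : D → ℝ) :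
    sampleMean P σ (fun xs => sampleMean P τ fun ys =>
        statistic a (sketch g xs) (sketch g ys) ^ 2) ≤
      (N ^ 2 * ∑ j, (bucketMass (P true) g j - bucketMass (P false) g j) ^ 2 / a j) ^ 2 +
      2 * N ^ 3 * ∑ j, (bucketMass (P true) g j + bucketMass (P false) g j) *
        (bucketMass (P true) g j - bucketMass (P false) g j) ^ 2 / a j ^ 2 +
      N ^ 2 * ∑ j, (bucketMass (P true) g j + bucketMass (P false) g j) ^ 2 / a j ^ 2 := by
  set δ : D → ℝ := fun j => bucketMass (P true) g j - bucketMass (P false) g j with hδ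
  set w : D → ℝ := fun j => bucketMass (P true) g j + bucketMass (P false) g j with hw
  have hw0 : ∀ j, 0 ≤ w j := fun j =>
    add_nonneg (bucketMass_nonneg (h0 _) g j) (bucketMass_nonneg (h0 _) g j)
  have lin : ∀ c : D → ℝ, sampleMean P σ (fun xs => (∑ j, c j * (sketch g xs j : ℝ)) ^ 2) ≤
      (N * ∑ j, δ j * c j) ^ 2 + N * ∑ j, w j * c j ^ 2 :=
    sampleMean_sq_linear_sketch_le h1 h0 ht hf g
  have inner : ∀ xs : List (Bool × α), sampleMean P τ (fun ys =>
      statistic a (sketch g xs) (sketch g ys) ^ 2) ≤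
      N ^ 2 * (∑ j, δ j / a j * (sketch g xs j : ℝ)) ^ 2 +
        N * ∑ j, w j / a j ^ 2 * (sketch g xs j : ℝ) ^ 2 := by
    intro xs
    have e : ∀ ys : List (Bool × α), statistic a (sketch g xs) (sketch g ys) =
        ∑ j, ((sketch g xs j : ℝ) / a j) * (sketch g ys j : ℝ) := fun ys =>
      Finset.sum_congr rfl fun j _ => by ring
    simp only [e]
    refine (sampleMean_sq_linear_sketch_le h1 h0 ht' hf' g _).trans (le_of_eq ?_)
    rw [mul_pow]
    congr 3
    · exact Finset.sum_congr rfl fun j _ => by simp only [hδ]; ring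
    · funext j
      ring
  refine (sampleMean_mono h0 σ inner).trans ?_
  rw [sampleMean_add, sampleMean_const_mul, sampleMean_const_mul, sampleMean_sum]
  simp only [sampleMean_const_mul]
  -- the second moment of one coordinate of the sketch
  have coord : ∀ i, sampleMean P σ (fun xs => (sketch g xs i : ℝ) ^ 2) ≤
      N ^ 2 * δ i ^ 2 + N * w i := by
    intro i
    simpa [mul_pow] using lin fun j => if j = i then 1 else 0
  have b1 := lin fun j => δ j / a j
  have b2 : ∑ j, w j / a j ^ 2 * sampleMean P σ (fun xs => (sketch g xs j : ℝ) ^ 2) ≤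
      ∑ j, w j / a j ^ 2 * (N ^ 2 * δ j ^ 2 + N * w j) :=
    Finset.sum_le_sum fun j _ =>
      mul_le_mul_of_nonneg_left (coord j) (div_nonneg (hw0 j) (sq_nonneg _))
  have hN : (0 : ℝ) ≤ N := Nat.cast_nonneg N
  refine (add_le_add (mul_le_mul_of_nonneg_left b1 (sq_nonneg _))
    (mul_le_mul_of_nonneg_left b2 hN)).trans (le_of_eq ?_)
  have r1 : ∑ j, δ j * (δ j / a j) = ∑ j, δ j ^ 2 / a j :=
    Finset.sum_congr rfl fun j _ => by ring
  have r2 : ∑ j, w j * (δ j / a j) ^ 2 = ∑ j, w j * δ j ^ 2 / a j ^ 2 :=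
    Finset.sum_congr rfl fun j _ => by ring
  have r3 : ∑ j, w j / a j ^ 2 * (N ^ 2 * δ j ^ 2 + N * w j) =
      N ^ 2 * ∑ j, w j * δ j ^ 2 / a j ^ 2 + N * ∑ j, w j ^ 2 / a j ^ 2 := by
    rw [Finset.mul_sum, Finset.mul_sum, ← Finset.sum_add_distrib]
    exact Finset.sum_congr rfl fun j _ => by ring
  rw [r1, r2, r3]
  ring

/-- Two equal laws are seldom told apart: the statistic is centred, and Chebyshev's inequality
applies. -/
theorem sampleMean_le_statistic_le (h1 : ∀ s, ∑ x, P s x = 1) (h0 : ∀ s x, 0 ≤ P s x)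
    (hP : P true = P false) {τ : List Bool} (ht : σ.count true = N) (hf : σ.count false = N)
    (ht' : τ.count true = N) (hf' : τ.count false = N) (g : α → D) (a : D → ℝ) {θ : ℝ}
    (hθ : 0 < θ) (s : Bool) :
    sampleMean P σ (fun xs => sampleMean P τ fun ys =>
        if θ ≤ statistic a (sketch g xs) (sketch g ys) then 1 else 0) ≤
      4 * N ^ 2 / θ ^ 2 * ∑ j, bucketMass (P s) g j ^ 2 / a j ^ 2 := by
  have hm : ∀ s' j, bucketMass (P s') g j = bucketMass (P s) g j := by
    intro s' j
    unfold bucketMass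
    cases s <;> cases s' <;> simp [hP]
  have cheb : ∀ xs ys : List (Bool × α),
      (if θ ≤ statistic a (sketch g xs) (sketch g ys) then (1 : ℝ) else 0) ≤
        1 / θ ^ 2 * statistic a (sketch g xs) (sketch g ys) ^ 2 := by
    intro xs ys
    split_ifs with h
    · rw [div_mul_eq_mul_div, one_mul, le_div_iff₀ (by positivity), one_mul]
      exact pow_le_pow_left₀ hθ.le h 2
    · positivity
  refine (sampleMean_mono h0 σ fun xs => sampleMean_mono h0 τ (cheb xs)).trans ?_
  simp only [sampleMean_const_mul]
  refine (mul_le_mul_of_nonneg_left (sampleMean_statistic_sq_le h1 h0 ht hf ht' hf' g a)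
    (by positivity)).trans (le_of_eq ?_)
  simp only [hm true, hm false, sub_self]
  have e : ∑ j, (bucketMass (P s) g j + bucketMass (P s) g j) ^ 2 / a j ^ 2 =
      4 * ∑ j, bucketMass (P s) g j ^ 2 / a j ^ 2 := by
    rw [Finset.mul_sum]
    exact Finset.sum_congr rfl fun j _ => by ring
  rw [e]
  simp
  ring

/-- The variance of the statistic in terms of one of the two laws only.  The other law enters
through the distance `Δ` of the two, which is dominated by the mean of the statistic. -/
theorem sampleMean_statistic_sub_sq_le (h1 : ∀ s, ∑ x, P s x = 1) (h0 : ∀ s x, 0 ≤ P s x)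
    {τ : List Bool} (ht : σ.count true = N) (hf : σ.count false = N) (ht' : τ.count true = N)
    (hf' : τ.count false = N) (g : α → D) {a : D → ℝ} (ha : ∀ j, 1 ≤ a j) (s : Bool) {Δ : ℝ}
    (hΔ : Δ = ∑ j, (bucketMass (P true) g j - bucketMass (P false) g j) ^ 2 / a j) :
    sampleMean P σ (fun xs => sampleMean P τ fun ys =>
        (statistic a (sketch g xs) (sketch g ys) - N ^ 2 * Δ) ^ 2) ≤
      101 * N ^ 2 * (8 * ∑ j, bucketMass (P s) g j ^ 2 / a j ^ 2 + 2 * Δ) +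
        1 / 100 * N ^ 4 * Δ ^ 2 := by
  set δ : D → ℝ := fun j => bucketMass (P true) g j - bucketMass (P false) g j with hδ
  set w : D → ℝ := fun j => bucketMass (P true) g j + bucketMass (P false) g j with hw
  have hm := sampleMean_statistic h1 ht hf ht' hf' g a
  have hs := sampleMean_statistic_sq_le h1 h0 ht hf ht' hf' g a
  rw [← hΔ] at hm hs
  have ha0 : ∀ j, 0 < a j := fun j => one_pos.trans_le (ha j)
  have hN : (0 : ℝ) ≤ N := Nat.cast_nonneg N
  have hsq : ∀ j, δ j ^ 2 / a j ^ 2 ≤ δ j ^ 2 / a j := fun j =>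
    div_le_div_of_nonneg_left (sq_nonneg _) (ha0 j) (by nlinarith [ha j])
  have hΔj : ∀ j, δ j ^ 2 / a j ≤ Δ := fun j => by
    rw [hΔ]
    exact Finset.single_le_sum (f := fun j => δ j ^ 2 / a j)
      (fun i _ => div_nonneg (sq_nonneg _) (ha0 i).le) (Finset.mem_univ j)
  have hA : ∑ j, w j ^ 2 / a j ^ 2 ≤ 8 * ∑ j, bucketMass (P s) g j ^ 2 / a j ^ 2 + 2 * Δ := by
    rw [hΔ, Finset.mul_sum, Finset.mul_sum, ← Finset.sum_add_distrib]
    refine Finset.sum_le_sum fun j _ => ?_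
    have : w j ^ 2 ≤ 8 * bucketMass (P s) g j ^ 2 + 2 * δ j ^ 2 := by
      simp only [hδ, hw]
      cases s
      · nlinarith [sq_nonneg (bucketMass (P true) g j - 3 * bucketMass (P false) g j)]
      · nlinarith [sq_nonneg (bucketMass (P false) g j - 3 * bucketMass (P true) g j)]
    calc w j ^ 2 / a j ^ 2 ≤ (8 * bucketMass (P s) g j ^ 2 + 2 * δ j ^ 2) / a j ^ 2 := by
          have := ha0 j; gcongr
      _ = 8 * (bucketMass (P s) g j ^ 2 / a j ^ 2) + 2 * (δ j ^ 2 / a j ^ 2) := by ring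
      _ ≤ _ := by have := hsq j; simp only [hδ] at this; linarith
  -- the mixed term, split between the two others by the inequality of the means; the weights are
  -- such that the multiple of the squared mean stays below `1 / 100`
  have hT : 2 * N ^ 3 * ∑ j, w j * δ j ^ 2 / a j ^ 2 ≤
      100 * N ^ 2 * ∑ j, w j ^ 2 / a j ^ 2 + 1 / 100 * N ^ 4 * Δ ^ 2 := by
    have h4 : ∑ j, (δ j ^ 2 / a j) ^ 2 ≤ Δ ^ 2 := by
      calc ∑ j, (δ j ^ 2 / a j) ^ 2 ≤ ∑ j, Δ * (δ j ^ 2 / a j) :=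
            Finset.sum_le_sum fun j _ => by
              rw [sq]
              exact mul_le_mul_of_nonneg_right (hΔj j) (div_nonneg (sq_nonneg _) (ha0 j).le)
        _ = Δ ^ 2 := by rw [← Finset.mul_sum, ← hΔ, sq]
    calc 2 * N ^ 3 * ∑ j, w j * δ j ^ 2 / a j ^ 2
        ≤ 100 * N ^ 2 * ∑ j, w j ^ 2 / a j ^ 2 +
            1 / 100 * N ^ 4 * ∑ j, (δ j ^ 2 / a j) ^ 2 := by
          rw [Finset.mul_sum, Finset.mul_sum, Finset.mul_sum, ← Finset.sum_add_distrib]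
          refine Finset.sum_le_sum fun j _ => ?_
          have e : 100 * (N : ℝ) ^ 2 * (w j ^ 2 / a j ^ 2) +
              1 / 100 * N ^ 4 * (δ j ^ 2 / a j) ^ 2 - 2 * N ^ 3 * (w j * δ j ^ 2 / a j ^ 2) =
              (10 * N * (w j / a j) - 1 / 10 * N ^ 2 * (δ j ^ 2 / a j)) ^ 2 := by ring
          nlinarith [sq_nonneg (10 * N * (w j / a j) - 1 / 10 * N ^ 2 * (δ j ^ 2 / a j))]
      _ ≤ _ := by gcongr
  have e : sampleMean P σ (fun xs => sampleMean P τ fun ys =>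
      (statistic a (sketch g xs) (sketch g ys) - N ^ 2 * Δ) ^ 2) =
      sampleMean P σ (fun xs => sampleMean P τ fun ys =>
        statistic a (sketch g xs) (sketch g ys) ^ 2) - (N ^ 2 * Δ) ^ 2 := by
    have e1 : ∀ W : ℝ, (W - N ^ 2 * Δ) ^ 2 = W ^ 2 + ((-2 * (N ^ 2 * Δ)) * W + (N ^ 2 * Δ) ^ 2) :=
      fun W => by ring
    simp only [e1, sampleMean_add, sampleMean_const_mul, sampleMean_const h1, hm]
    ring
  have hN2 : 0 ≤ 101 * (N : ℝ) ^ 2 := by positivity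
  rw [e]
  linarith [mul_le_mul_of_nonneg_left hA hN2]

/-- Two distant laws are seldom taken for equal, by Chebyshev's inequality. -/
theorem sampleMean_statistic_lt_le (h1 : ∀ s, ∑ x, P s x = 1) (h0 : ∀ s x, 0 ≤ P s x)
    {τ : List Bool} (hN : 0 < N) (ht : σ.count true = N) (hf : σ.count false = N)
    (ht' : τ.count true = N)
    (hf' : τ.count false = N) (g : α → D) {a : D → ℝ} (ha : ∀ j, 1 ≤ a j) (s : Bool) {β : ℝ}
    (hβ : 0 < β)
    (hΔ : β ≤ ∑ j, (bucketMass (P true) g j - bucketMass (P false) g j) ^ 2 / a j) :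
    sampleMean P σ (fun xs => sampleMean P τ fun ys =>
        if statistic a (sketch g xs) (sketch g ys) < N ^ 2 * β / 2 then 1 else 0) ≤
      3232 / (N ^ 2 * β ^ 2) * (∑ j, bucketMass (P s) g j ^ 2 / a j ^ 2) +
        808 / (N ^ 2 * β) + 1 / 25 := by
  obtain ⟨Δ, hΔe⟩ : ∃ Δ, Δ = ∑ j, (bucketMass (P true) g j - bucketMass (P false) g j) ^ 2 / a j :=
    ⟨_, rfl⟩
  rw [← hΔe] at hΔ
  have hN' : (0 : ℝ) < N := by exact_mod_cast hN
  have hΔ0 : 0 < Δ := hβ.trans_le hΔ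
  have cheb : ∀ xs ys : List (Bool × α),
      (if statistic a (sketch g xs) (sketch g ys) < N ^ 2 * β / 2 then (1 : ℝ) else 0) ≤
        4 / (N ^ 4 * Δ ^ 2) * (statistic a (sketch g xs) (sketch g ys) - N ^ 2 * Δ) ^ 2 := by
    intro xs ys
    split_ifs with h
    · rw [div_mul_eq_mul_div, le_div_iff₀ (by positivity), one_mul]
      have h' : N ^ 2 * β ≤ N ^ 2 * Δ := by gcongr
      have : 0 ≤ N ^ 2 * Δ / 2 := by positivity
      nlinarith
    · positivity
  refine (sampleMean_mono h0 σ fun xs => sampleMean_mono h0 τ (cheb xs)).trans ?_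
  simp only [sampleMean_const_mul]
  refine (mul_le_mul_of_nonneg_left
    (sampleMean_statistic_sub_sq_le h1 h0 ht hf ht' hf' g ha s hΔe) (by positivity)).trans ?_
  obtain ⟨Q, hQ⟩ : ∃ Q, Q = ∑ j, bucketMass (P s) g j ^ 2 / a j ^ 2 := ⟨_, rfl⟩
  have hQ0 : 0 ≤ Q := hQ ▸ Finset.sum_nonneg fun j _ => by positivity
  rw [← hQ]
  have e : 4 / (N ^ 4 * Δ ^ 2) * (101 * N ^ 2 * (8 * Q + 2 * Δ) + 1 / 100 * N ^ 4 * Δ ^ 2) =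
      3232 / (N ^ 2 * Δ ^ 2) * Q + 808 / (N ^ 2 * Δ) + 1 / 25 := by
    field_simp
    ring
  rw [e]
  gcongr

end Sketch

/-! ### Hashing the elements that have not been recorded -/

section Buckets

variable {κ B : Type*} [DecidableEq κ]

/-- The buckets of the statistic: each recorded element is a bucket of its own, all others are
hashed. -/
def bucketOf (l : List κ) (h : κ → B) (x : κ) : κ ⊕ B := if x ∈ l then .inl x else .inr (h x)

/-- The weight of a bucket: one more than the number of records of its element, and one for the
buckets that receive hashed elements. -/
noncomputable def bucketWeight (l : List κ) : κ ⊕ B → ℝ :=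
  Sum.elim (fun i => 1 + l.count i) fun _ => 1

theorem one_le_bucketWeight (l : List κ) (j : κ ⊕ B) : 1 ≤ bucketWeight l j := by
  rcases j with i | b <;> simp [bucketWeight]

end Buckets

section Collision

variable {Ω κ B : Type*} [Fintype Ω] [Fintype κ] [DecidableEq κ] [Fintype B] [DecidableEq B]

/-- The part of `∑ b, bucketMass f h b ^ 2` that is due to collisions. -/
noncomputable def collisionSum (f : κ → ℝ) (h : κ → B) : ℝ :=
  ∑ p ∈ (Finset.univ : Finset κ).offDiag, f p.1 * f p.2 * if h p.1 = h p.2 then 1 else 0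

theorem sum_eq_sum_diag_add_sum_offDiag (F : κ → κ → ℝ) :
    ∑ x, ∑ y, F x y = ∑ x, F x x + ∑ p ∈ (Finset.univ : Finset κ).offDiag, F p.1 p.2 := by
  rw [← Finset.sum_product', ← Finset.diag_union_offDiag,
    Finset.sum_union (Finset.disjoint_diag_offDiag _), Finset.sum_diag]

theorem sum_bucketMass_sq (f : κ → ℝ) (h : κ → B) :
    ∑ b, bucketMass f h b ^ 2 = ∑ x, f x ^ 2 + collisionSum f h := by
  have e := sum_eq_sum_diag_add_sum_offDiag fun x y : κ =>
    f x * f y * if h x = h y then (1 : ℝ) else 0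
  simp only [if_true, mul_one, ← sq] at e
  rw [collisionSum, ← e]
  simp only [sq, sum_bucketMass_mul]
  refine Finset.sum_congr rfl fun x _ => ?_
  rw [bucketMass, Finset.mul_sum]
  refine Finset.sum_congr rfl fun y _ => ?_
  by_cases hxy : h x = h y
  · simp [hxy]
  · simp [hxy, Ne.symm hxy]

theorem sum_offDiag_mul (f : κ → ℝ) :
    ∑ p ∈ (Finset.univ : Finset κ).offDiag, f p.1 * f p.2 = (∑ x, f x) ^ 2 - ∑ x, f x ^ 2 := by
  have e := sum_eq_sum_diag_add_sum_offDiag fun x y : κ => f x * f y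
  rw [← Finset.sum_mul_sum, ← sq] at e
  simp only [← sq] at e
  linarith

theorem sum_collisionSum {h : Ω → κ → B} (hh : IsPairHash h) (f : κ → ℝ) :
    ∑ ω, collisionSum f (h ω) =
      Fintype.card Ω / Fintype.card B * ((∑ x, f x) ^ 2 - ∑ x, f x ^ 2) := by
  simp only [collisionSum]
  rw [Finset.sum_comm, ← sum_offDiag_mul, Finset.mul_sum]
  refine Finset.sum_congr rfl fun p hp => ?_
  rw [← Finset.mul_sum, hh.collision _ _ (Finset.mem_offDiag.1 hp).2.2, mul_comm]

/-- The variance of the collision part: collisions of different pairs are uncorrelated. -/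
theorem sum_collisionSum_sub_sq_le [Nonempty B] {h : Ω → κ → B} (hh : IsPairHash h) (f : κ → ℝ) :
    ∑ ω, (collisionSum f (h ω) - ((∑ x, f x) ^ 2 - ∑ x, f x ^ 2) / Fintype.card B) ^ 2 ≤
      2 * Fintype.card Ω / Fintype.card B * (∑ x, f x ^ 2) ^ 2 := by
  set r : ℝ := (Fintype.card B : ℝ) with hr
  have hr0 : 0 < r := by rw [hr]; exact_mod_cast Fintype.card_pos
  set O := (Finset.univ : Finset κ).offDiag with hO
  let c : κ × κ → Ω → ℝ := fun p ω => if h ω p.1 = h ω p.2 then 1 else 0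
  let u : κ × κ → ℝ := fun p => f p.1 * f p.2
  set V : ℝ := Fintype.card Ω * (1 / r - 1 / r ^ 2) with hV
  have hmean : ∀ p ∈ O, ∑ ω, c p ω = Fintype.card Ω / r := fun p hp =>
    hh.collision _ _ (Finset.mem_offDiag.1 hp).2.2
  have hcov : ∀ p ∈ O, ∀ p' ∈ O, ∑ ω, (c p ω - 1 / r) * (c p' ω - 1 / r) =
      (if p' = p then V else 0) + if p' = p.swap then V else 0 := by
    intro p hp p' hp'
    have hpne := (Finset.mem_offDiag.1 hp).2.2
    have hpne' := (Finset.mem_offDiag.1 hp').2.2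
    have e : ∑ ω, (c p ω - 1 / r) * (c p' ω - 1 / r) =
        ∑ ω, c p ω * c p' ω - Fintype.card Ω / r ^ 2 := by
      have : ∀ ω, (c p ω - 1 / r) * (c p' ω - 1 / r) =
          c p ω * c p' ω - c p ω * (1 / r) - c p' ω * (1 / r) + 1 / r ^ 2 := fun ω => by ring
      simp only [this, Finset.sum_add_distrib, Finset.sum_sub_distrib, ← Finset.sum_mul,
        hmean p hp, hmean p' hp', Finset.sum_const, Finset.card_univ, nsmul_eq_mul]
      ring
    have hidem : ∀ q : κ × κ, ∀ ω, c q ω * c q ω = c q ω := fun q ω => by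
      simp only [c]; split_ifs <;> simp
    rw [e]
    by_cases h1 : p' = p
    · subst h1
      have h2 : p' ≠ p'.swap := fun h => hpne (congrArg Prod.fst h)
      simp only [hidem, hmean p' hp', if_true, if_neg h2, hV]
      ring
    by_cases h2 : p' = p.swap
    · have hc : ∀ ω, c p' ω = c p ω := fun ω => by
        simp only [c, h2, Prod.fst_swap, Prod.snd_swap, eq_comm]
      simp only [hc, hidem, hmean p hp, if_neg h1, if_pos h2, hV]
      ring
    · have := hh.collision_collision p.1 p.2 p'.1 p'.2 hpne hpne'
        (fun h => h1 (Prod.ext h.1.symm h.2.symm)) (fun h => h2 (Prod.ext h.2.symm h.1.symm))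
      simp only [if_neg h1, if_neg h2, c, this, ← hr]
      ring
  have hswap : ∀ p ∈ O, p.swap ∈ O := fun p hp => by
    rw [hO, Finset.mem_offDiag] at hp ⊢
    exact ⟨hp.2.1, hp.1, hp.2.2.symm⟩
  have hsub : ∀ ω, collisionSum f (h ω) - ((∑ x, f x) ^ 2 - ∑ x, f x ^ 2) / r =
      ∑ p ∈ O, u p * (c p ω - 1 / r) := by
    intro ω
    simp only [mul_sub, Finset.sum_sub_distrib, ← Finset.sum_mul, u]
    rw [hO, sum_offDiag_mul, mul_one_div]
    rfl
  have hexp : ∀ ω, (∑ p ∈ O, u p * (c p ω - 1 / r)) ^ 2 =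
      ∑ p ∈ O, ∑ p' ∈ O, u p * u p' * ((c p ω - 1 / r) * (c p' ω - 1 / r)) := by
    intro ω
    rw [sq, Finset.sum_mul_sum]
    exact Finset.sum_congr rfl fun p _ => Finset.sum_congr rfl fun p' _ => by ring
  have hVle : V ≤ Fintype.card Ω / r := by
    rw [hV, mul_sub, mul_one_div]
    have : 0 ≤ (Fintype.card Ω : ℝ) * (1 / r ^ 2) := by positivity
    linarith
  have hu2 : ∑ p ∈ O, u p ^ 2 ≤ (∑ x, f x ^ 2) ^ 2 := by
    have := sum_offDiag_mul fun x => f x ^ 2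
    have h4 : 0 ≤ ∑ x, (f x ^ 2) ^ 2 := Finset.sum_nonneg fun _ _ => by positivity
    simp only [u, mul_pow]
    linarith
  calc ∑ ω, (collisionSum f (h ω) - ((∑ x, f x) ^ 2 - ∑ x, f x ^ 2) / r) ^ 2
      = ∑ p ∈ O, ∑ p' ∈ O, u p * u p' * ∑ ω, (c p ω - 1 / r) * (c p' ω - 1 / r) := by
        simp only [hsub, hexp]
        rw [Finset.sum_comm]
        refine Finset.sum_congr rfl fun p _ => ?_
        rw [Finset.sum_comm]
        exact Finset.sum_congr rfl fun p' _ => by rw [Finset.mul_sum]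
    _ = ∑ p ∈ O, 2 * V * u p ^ 2 := by
        refine Finset.sum_congr rfl fun p hp => ?_
        rw [Finset.sum_congr rfl fun p' hp' => by rw [hcov p hp p' hp']]
        simp only [mul_add, mul_ite, mul_zero, Finset.sum_add_distrib, Finset.sum_ite_eq',
          if_pos hp, if_pos (hswap p hp)]
        simp only [u, Prod.fst_swap, Prod.snd_swap]
        ring
    _ = 2 * V * ∑ p ∈ O, u p ^ 2 := by rw [Finset.mul_sum]
    _ ≤ 2 * (Fintype.card Ω / r) * (∑ x, f x ^ 2) ^ 2 := by
        have h0 : 0 ≤ ∑ p ∈ O, u p ^ 2 := Finset.sum_nonneg fun _ _ => sq_nonneg _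
        have : 0 ≤ (Fintype.card Ω : ℝ) / r := by positivity
        gcongr
    _ = _ := by ring

/-- With at least `256` buckets, collisions seldom destroy half of the squared norm `S`. -/
theorem sum_collisionSum_lt_le [Nonempty B] (hB : 256 ≤ Fintype.card B) {h : Ω → κ → B}
    (hh : IsPairHash h) (f : κ → ℝ) {S : ℝ} (hS : 0 < S) (hf : ∑ x, f x ^ 2 ≤ S) :
    (∑ ω, if S + collisionSum f (h ω) < S / 2 then (1 : ℝ) else 0) ≤ 1 / 8 * Fintype.card Ω := by
  set r : ℝ := (Fintype.card B : ℝ) with hr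
  have hr256 : (256 : ℝ) ≤ r := by rw [hr]; exact_mod_cast hB
  have hf0 : 0 ≤ ∑ x, f x ^ 2 := Finset.sum_nonneg fun _ _ => sq_nonneg _
  have cheb : ∀ ω, (if S + collisionSum f (h ω) < S / 2 then (1 : ℝ) else 0) ≤
      16 / S ^ 2 * (collisionSum f (h ω) - ((∑ x, f x) ^ 2 - ∑ x, f x ^ 2) / r) ^ 2 := by
    intro ω
    split_ifs with hω
    · rw [div_mul_eq_mul_div, le_div_iff₀ (by positivity), one_mul]
      have hmean : -(S / 4) ≤ ((∑ x, f x) ^ 2 - ∑ x, f x ^ 2) / r := by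
        rw [le_div_iff₀ (by linarith)]
        nlinarith [sq_nonneg (∑ x, f x)]
      nlinarith
    · positivity
  refine (Finset.sum_le_sum fun ω _ => cheb ω).trans ?_
  rw [← Finset.mul_sum]
  calc 16 / S ^ 2 * ∑ ω, (collisionSum f (h ω) - ((∑ x, f x) ^ 2 - ∑ x, f x ^ 2) / r) ^ 2
      ≤ 16 / S ^ 2 * (2 * Fintype.card Ω / 256 * S ^ 2) := by
        refine mul_le_mul_of_nonneg_left
          ((sum_collisionSum_sub_sq_le hh f).trans ?_) (by positivity)
        rw [← hr]
        gcongr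
    _ = 1 / 8 * (Fintype.card Ω : ℝ) := by field_simp; ring

theorem sum_bucketMass_sq_div (l : List κ) (h : κ → B) (f : κ → ℝ) (e : ℕ) :
    ∑ j, bucketMass f (bucketOf l h) j ^ 2 / bucketWeight l j ^ e =
      ∑ i, f i ^ 2 / (1 + l.count i : ℝ) ^ e +
        collisionSum (fun x => if x ∈ l then 0 else f x) h := by
  have hl : ∀ i, bucketMass f (bucketOf l h) (.inl i) = if i ∈ l then f i else 0 := by
    intro i
    have : ∀ x, (if bucketOf l h x = .inl i then f x else 0) =
        if x = i then (if i ∈ l then f i else 0) else 0 := by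
      intro x
      unfold bucketOf
      by_cases hx : x ∈ l <;> by_cases hxi : x = i <;> grind
    simp [bucketMass, this]
  have hr : ∀ b, bucketMass f (bucketOf l h) (.inr b) =
      bucketMass (fun x => if x ∈ l then 0 else f x) h b := by
    intro b
    unfold bucketMass bucketOf
    refine Finset.sum_congr rfl fun x _ => ?_
    by_cases hx : x ∈ l <;> simp [hx]
  rw [Fintype.sum_sum_type]
  simp only [hl, hr, bucketWeight, Sum.elim_inl, Sum.elim_inr, one_pow, div_one]
  rw [sum_bucketMass_sq, ← add_assoc, ← Finset.sum_add_distrib]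
  congr 1
  refine Finset.sum_congr rfl fun i _ => ?_
  by_cases hi : i ∈ l
  · simp [hi]
  · simp [hi, List.count_eq_zero_of_not_mem hi]

/-- On average over the hash functions, the weighted squared norm of a law is little more than
without collisions. -/
theorem sum_sum_bucketMass_sq_div_le {h : Ω → κ → B} (hh : IsPairHash h) (l : List κ)
    {f : κ → ℝ} (h0 : ∀ x, 0 ≤ f x) (h1 : ∑ x, f x = 1) :
    ∑ ω, ∑ j, bucketMass f (bucketOf l (h ω)) j ^ 2 / bucketWeight l j ^ 2 ≤
      Fintype.card Ω * (∑ i, f i ^ 2 / (1 + l.count i : ℝ) ^ 2 + 1 / Fintype.card B) := by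
  simp only [sum_bucketMass_sq_div, Finset.sum_add_distrib, Finset.sum_const, Finset.card_univ,
    nsmul_eq_mul, sum_collisionSum hh]
  rw [mul_add]
  refine add_le_add_right ?_ _
  have hle : ∑ x, (if x ∈ l then 0 else f x) ≤ 1 :=
    h1 ▸ Finset.sum_le_sum fun x _ => by split_ifs <;> simp [h0]
  have hnn : 0 ≤ ∑ x, (if x ∈ l then 0 else f x) :=
    Finset.sum_nonneg fun x _ => by split_ifs <;> simp [h0]
  have hsq : 0 ≤ ∑ x, (if x ∈ l then 0 else f x) ^ 2 := Finset.sum_nonneg fun _ _ => sq_nonneg _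
  calc _ ≤ (Fintype.card Ω : ℝ) / Fintype.card B * 1 := by
        refine mul_le_mul_of_nonneg_left ?_ (by positivity)
        nlinarith
    _ = _ := by ring

/-- For most hash functions, the weighted squared norm is at least half of its value without
collisions. -/
theorem sum_sum_bucketMass_sq_div_lt_le [Nonempty B] (hB : 256 ≤ Fintype.card B) {h : Ω → κ → B}
    (hh : IsPairHash h) (l : List κ) (f : κ → ℝ) {S : ℝ} (hS : 0 < S)
    (hf : S ≤ ∑ i, f i ^ 2 / (1 + l.count i : ℝ)) :
    (∑ ω, if ∑ j, bucketMass f (bucketOf l (h ω)) j ^ 2 / bucketWeight l j < S / 2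
      then (1 : ℝ) else 0) ≤ 1 / 8 * Fintype.card Ω := by
  have e : ∀ ω, ∑ j, bucketMass f (bucketOf l (h ω)) j ^ 2 / bucketWeight l j =
      ∑ i, f i ^ 2 / (1 + l.count i : ℝ) +
        collisionSum (fun x => if x ∈ l then 0 else f x) (h ω) := fun ω => by
    simpa only [pow_one] using sum_bucketMass_sq_div l (h ω) f 1
  simp only [e]
  refine le_trans (Finset.sum_le_sum fun ω _ => ?_)
    (sum_collisionSum_lt_le hB hh (fun x => if x ∈ l then 0 else f x) (hS.trans_le hf)
      (Finset.sum_le_sum fun x _ => ?_))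
  · split_ifs with ha hb
    · exact le_rfl
    · exact absurd (ha.trans_le (by gcongr)) hb
    · exact zero_le_one
    · exact le_rfl
  · by_cases hx : x ∈ l
    · rw [if_pos hx, zero_pow two_ne_zero]
      positivity
    · simp [hx, List.count_eq_zero_of_not_mem hx]

end Collision

/-! ### Recording samples to flatten the laws -/

section Flattening

variable {κ : Type*} [Fintype κ] [DecidableEq κ]

theorem sum_count_eq_length (l : List κ) : ∑ i, l.count i = l.length := by
  induction l with
  | nil => simp
  | cons x l ih => simp [List.count_cons, Finset.sum_add_distrib, ih]

/-- By the Cauchy-Schwarz inequality, weighting does not make distant laws look close. -/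
theorem sq_sum_abs_div_le (l : List κ) (f : κ → ℝ) :
    (∑ i, |f i|) ^ 2 ≤ (∑ i, f i ^ 2 / (1 + l.count i : ℝ)) * (Fintype.card κ + l.length) := by
  have hsum : ∑ i, (1 + l.count i : ℝ) = Fintype.card κ + l.length := by
    rw [Finset.sum_add_distrib, ← sum_count_eq_length l]
    simp
  rw [← hsum]
  refine Finset.sum_sq_le_sum_mul_sum_of_sq_le_mul _ (fun i _ => by positivity)
    (fun i _ => by positivity) fun i _ => ?_
  have : (1 + l.count i : ℝ) ≠ 0 := by positivity
  rw [sq_abs, div_mul_cancel₀ _ this]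

variable {P : Bool → κ → ℝ}

/-- The potential `1 / (1 + number of records)` of an element pays for the expected values of
`1 / ((1 + c) * (2 + c))`, by which it drops whenever the element is recorded once more. -/
theorem sampleMean_count_potential (h1 : ∀ s, ∑ x, P s x = 1) (h0 : ∀ s x, 0 ≤ P s x)
    (s : Bool) (i : κ) (σ : List Bool) (a : ℕ) :
    σ.count s * P s i * sampleMean P σ (fun xs =>
        1 / ((1 + a + (xs.map Prod.snd).count i : ℝ) * (2 + a + (xs.map Prod.snd).count i))) +
      sampleMean P σ (fun xs => 1 / (1 + a + (xs.map Prod.snd).count i : ℝ)) ≤ 1 / (1 + a) := by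
  induction σ generalizing a with
  | nil => simp [sampleMean]
  | cons t σ ih =>
    set G : ℕ → ℝ := fun a => sampleMean P σ (fun xs =>
        1 / ((1 + a + (xs.map Prod.snd).count i : ℝ) * (2 + a + (xs.map Prod.snd).count i)))
      with hG
    set H : ℕ → ℝ := fun a =>
      sampleMean P σ (fun xs => 1 / (1 + a + (xs.map Prod.snd).count i : ℝ)) with hH
    have hstep : ∀ x (l : List (Bool × κ)), ((((t, x) :: l).map Prod.snd).count i : ℝ) =
        (if x = i then 1 else 0 : ℕ) + ((l.map Prod.snd).count i : ℝ) := by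
      intro x l
      rw [List.map_cons, List.count_cons, add_comm]
      by_cases hx : x = i <;> simp [hx]
    have eG : sampleMean P (t :: σ) (fun xs => 1 / ((1 + a + (xs.map Prod.snd).count i : ℝ) *
        (2 + a + (xs.map Prod.snd).count i))) =
        ∑ x, P t x * G (a + if x = i then 1 else 0) := by
      simp only [sampleMean, hstep, hG]
      refine Finset.sum_congr rfl fun x _ => ?_
      push_cast
      simp only [add_assoc]
    have eH : sampleMean P (t :: σ) (fun xs => 1 / (1 + a + (xs.map Prod.snd).count i : ℝ)) =
        ∑ x, P t x * H (a + if x = i then 1 else 0) := by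
      simp only [sampleMean, hstep, hH]
      refine Finset.sum_congr rfl fun x _ => ?_
      push_cast
      simp only [add_assoc]
    rw [eG, eH]
    set g : ℝ := 1 / ((1 + a) * (2 + a)) with hg
    have hGle : ∀ b, a ≤ b → G b ≤ g := by
      intro b hab
      rw [← sampleMean_const (P := P) h1 σ g]
      refine sampleMean_mono h0 σ fun xs => ?_
      have hab' : (a : ℝ) ≤ b := by exact_mod_cast hab
      have hc : (0 : ℝ) ≤ (xs.map Prod.snd).count i := Nat.cast_nonneg _
      exact one_div_le_one_div_of_le (by positivity)
        (mul_le_mul (by linarith) (by linarith) (by positivity) (by positivity))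
    have hmean : ∑ x, P t x * G (a + if x = i then 1 else 0) ≤ g := by
      calc _ ≤ ∑ x, P t x * g := Finset.sum_le_sum fun x _ =>
            mul_le_mul_of_nonneg_left (hGle _ (Nat.le_add_right _ _)) (h0 t x)
        _ = g := by rw [← Finset.sum_mul, h1, one_mul]
    have hdrop : ∑ x, P t x * (1 / (1 + (a + if x = i then 1 else 0 : ℕ)) : ℝ) =
        1 / (1 + a) - P t i * g := by
      have : ∀ x, P t x * (1 / (1 + (a + if x = i then 1 else 0 : ℕ)) : ℝ) =
          P t x * (1 / (1 + a)) - if x = i then P t i * g else 0 := by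
        intro x
        by_cases hx : x = i
        · subst hx
          have h3 : (1 + (a + 1) : ℝ) ≠ 0 := by positivity
          have h2 : (2 + a : ℝ) ≠ 0 := by positivity
          simp only [if_true, hg]
          push_cast
          field_simp
          ring
        · simp [hx]
      simp only [this, Finset.sum_sub_distrib, ← Finset.sum_mul, h1, one_mul, Finset.sum_ite_eq',
        Finset.mem_univ, if_true]
    have hih : ∑ x, P t x * (σ.count s * P s i * G (a + if x = i then 1 else 0) +
        H (a + if x = i then 1 else 0)) ≤ 1 / (1 + a) - P t i * g := by
      rw [← hdrop]
      exact Finset.sum_le_sum fun x _ => mul_le_mul_of_nonneg_left (ih _) (h0 t x)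
    have hsplit : ∑ x, P t x * (σ.count s * P s i * G (a + if x = i then 1 else 0) +
        H (a + if x = i then 1 else 0)) =
        σ.count s * P s i * ∑ x, P t x * G (a + if x = i then 1 else 0) +
          ∑ x, P t x * H (a + if x = i then 1 else 0) := by
      rw [Finset.mul_sum, ← Finset.sum_add_distrib]
      exact Finset.sum_congr rfl fun x _ => by ring
    have hg0 : 0 ≤ g := by positivity
    by_cases hts : t = s
    · subst hts
      rw [List.count_cons_self]
      push_cast
      nlinarith [mul_le_mul_of_nonneg_left hmean (h0 t i)]
    · rw [List.count_cons_of_ne hts]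
      nlinarith [mul_nonneg (h0 t i) hg0]

/-- Recording `n` samples of a law brings the weighted squared norm of this law down to `2 / n`. -/
theorem sampleMean_sum_sq_div_count_le (h1 : ∀ s, ∑ x, P s x = 1) (h0 : ∀ s x, 0 ≤ P s x)
    (s : Bool) (σ : List Bool) (hσ : 0 < σ.count s) :
    sampleMean P σ (fun xs => ∑ i, P s i ^ 2 / (1 + (xs.map Prod.snd).count i : ℝ) ^ 2) ≤
      2 / σ.count s := by
  have hn : (0 : ℝ) < σ.count s := by exact_mod_cast hσ
  rw [sampleMean_sum]
  have hi : ∀ i, sampleMean P σ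
      (fun xs => P s i ^ 2 / (1 + (xs.map Prod.snd).count i : ℝ) ^ 2) ≤
      2 / σ.count s * P s i := by
    intro i
    have hpot := sampleMean_count_potential h1 h0 s i σ 0
    simp only [Nat.cast_zero, add_zero, div_one] at hpot
    have hpos : 0 ≤ sampleMean P σ (fun xs => 1 / (1 + (xs.map Prod.snd).count i : ℝ)) := by
      rw [← sampleMean_zero (P := P) σ]
      exact sampleMean_mono h0 σ fun xs => by positivity
    have hle : sampleMean P σ (fun xs => P s i ^ 2 / (1 + (xs.map Prod.snd).count i : ℝ) ^ 2) ≤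
        2 * P s i ^ 2 * sampleMean P σ (fun xs => 1 / ((1 + (xs.map Prod.snd).count i : ℝ) *
          (2 + (xs.map Prod.snd).count i))) := by
      rw [← sampleMean_const_mul]
      refine sampleMean_mono h0 σ fun xs => ?_
      have hc : (0 : ℝ) ≤ (xs.map Prod.snd).count i := Nat.cast_nonneg _
      rw [mul_one_div, div_le_div_iff₀ (by positivity) (by positivity)]
      nlinarith [mul_nonneg (sq_nonneg (P s i)) hc, mul_nonneg (sq_nonneg (P s i)) (sq_nonneg
        ((xs.map Prod.snd).count i : ℝ))]
    refine hle.trans ?_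
    rw [div_mul_eq_mul_div, le_div_iff₀ hn]
    nlinarith [h0 s i]
  calc _ ≤ ∑ i, 2 / σ.count s * P s i := Finset.sum_le_sum fun i _ => hi i
    _ = 2 / σ.count s := by rw [← Finset.mul_sum, h1, mul_one]

end Flattening

/-! ### The tester -/

section Tester

variable {Ω κ B : Type*} [DecidableEq κ] [DecidableEq B]

/-- A state of the tester. -/
@[ext]
structure TesterState (Ω κ B : Type*) where
  /-- index of the hash function -/
  seed : Ω
  /-- the recorded elements -/
  recorded : List κ
  /-- how many samples of each stream have entered the sketches -/
  seen : Bool → ℕ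
  /-- sketch of the first batch of samples -/
  first : κ ⊕ B → ℤ
  /-- sketch of the second batch of samples -/
  second : κ ⊕ B → ℤ

/-- The effect of a sample: the first `s` samples are recorded; of the following ones, `N` of each
stream enter the first sketch and then `N` of each stream the second one, and the rest is ignored. -/
def TesterState.step (s N : ℕ) (h : Ω → κ → B) (st : TesterState Ω κ B) (y : Bool × κ) :
    TesterState Ω κ B :=
  if st.recorded.length < s then { st with recorded := y.2 :: st.recorded }
  else if st.seen y.1 < N then
    { st with
      seen := Function.update st.seen y.1 (st.seen y.1 + 1)
      first := fun j => st.first j +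
        if bucketOf st.recorded (h st.seed) y.2 = j then streamSign y.1 else 0 }
  else if st.seen y.1 < 2 * N then
    { st with
      seen := Function.update st.seen y.1 (st.seen y.1 + 1)
      second := fun j => st.second j +
        if bucketOf st.recorded (h st.seed) y.2 = j then streamSign y.1 else 0 }
  else st

/-- The state before the first sample. -/
def TesterState.start (ω : Ω) : TesterState Ω κ B := ⟨ω, [], fun _ => 0, fun _ => 0, fun _ => 0⟩

theorem foldl_step_of_length_le (s N : ℕ) (h : Ω → κ → B) (xs : List (Bool × κ))
    (st : TesterState Ω κ B) (hs : xs.length + st.recorded.length ≤ s) :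
    xs.foldl (TesterState.step s N h) st =
      { st with recorded := (xs.map Prod.snd).reverse ++ st.recorded } := by
  induction xs generalizing st with
  | nil => rfl
  | cons y xs ih =>
    have hlt : st.recorded.length < s := by simp only [List.length_cons] at hs; omega
    have hstep : st.step s N h y = { st with recorded := y.2 :: st.recorded } := by
      rw [TesterState.step, if_pos hlt]
    rw [List.foldl_cons, hstep, ih _ (by simp only [List.length_cons] at hs ⊢; omega)]
    simp

variable [Fintype κ] {P : Bool → κ → ℝ}

/-- Once the recording is over, the two sketches are those of independent batches of samples,
whatever the order in which the streams are interleaved. -/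
theorem exists_batches (h1 : ∀ s, ∑ x, P s x = 1) (s N : ℕ) (h : Ω → κ → B) (σ : List Bool)
    (seen : Bool → ℕ) (hσ : ∀ b, 2 * N ≤ seen b + σ.count b) :
    ∃ σ₁ σ₂ : List Bool, (∀ b, σ₁.count b = N - seen b) ∧
      (∀ b, σ₂.count b = 2 * N - max N (seen b)) ∧
      ∀ (st : TesterState Ω κ B), s ≤ st.recorded.length → st.seen = seen →
        ∀ Φ : (κ ⊕ B → ℤ) → (κ ⊕ B → ℤ) → ℝ,
        sampleMean P σ (fun xs => Φ (xs.foldl (TesterState.step s N h) st).first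
            (xs.foldl (TesterState.step s N h) st).second) =
          sampleMean P σ₁ fun xs => sampleMean P σ₂ fun ys =>
            Φ (fun j => st.first j + sketch (bucketOf st.recorded (h st.seed)) xs j)
              (fun j => st.second j + sketch (bucketOf st.recorded (h st.seed)) ys j) := by
  induction σ generalizing seen with
  | nil =>
    refine ⟨[], [], fun b => ?_, fun b => ?_, fun st _ _ Φ => by simp [sampleMean, sketch]⟩
    · have := hσ b; simp only [List.count_nil] at this ⊢; omega
    · have := hσ b; simp only [List.count_nil] at this ⊢; omega
  | cons t σ ih =>
    have hσ' : ∀ b, 2 * N ≤ Function.update seen t (seen t + 1) b + σ.count b := by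
      intro b
      have := hσ b
      by_cases hb : b = t
      · subst hb; rw [List.count_cons_self] at this; rw [Function.update_self]; omega
      · rw [List.count_cons_of_ne (Ne.symm hb)] at this; rwa [Function.update_of_ne hb]
    by_cases hA : seen t < N
    · obtain ⟨σ₁, σ₂, hc1, hc2, hE⟩ := ih _ hσ'
      refine ⟨t :: σ₁, σ₂, fun b => ?_, fun b => ?_, fun st hs hst Φ => ?_⟩
      · by_cases hb : b = t
        · subst hb; rw [List.count_cons_self, hc1, Function.update_self]; omega
        · rw [List.count_cons_of_ne (Ne.symm hb), hc1, Function.update_of_ne hb]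
      · rw [hc2]
        by_cases hb : b = t
        · subst hb; rw [Function.update_self]; omega
        · rw [Function.update_of_ne hb]
      · simp only [sampleMean, List.foldl_cons]
        refine Finset.sum_congr rfl fun x _ => ?_
        have hstep : st.step s N h (t, x) =
            { st with
              seen := Function.update seen t (seen t + 1)
              first := fun j => st.first j +
                if bucketOf st.recorded (h st.seed) x = j then streamSign t else 0 } := by
          rw [TesterState.step, if_neg (by omega), hst, if_pos hA]
        rw [hE _ (by rw [hstep]; exact hs) (by rw [hstep])]
        simp only [hstep, sketch, List.map_cons, List.sum_cons, add_assoc]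
    by_cases hB : seen t < 2 * N
    · obtain ⟨σ₁, σ₂, hc1, hc2, hE⟩ := ih _ hσ'
      refine ⟨σ₁, t :: σ₂, fun b => ?_, fun b => ?_, fun st hs hst Φ => ?_⟩
      · rw [hc1]
        by_cases hb : b = t
        · subst hb; rw [Function.update_self]; omega
        · rw [Function.update_of_ne hb]
      · by_cases hb : b = t
        · subst hb; rw [List.count_cons_self, hc2, Function.update_self]; omega
        · rw [List.count_cons_of_ne (Ne.symm hb), hc2, Function.update_of_ne hb]
      · simp only [sampleMean, List.foldl_cons]
        rw [sampleMean_sum]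
        refine Finset.sum_congr rfl fun x _ => ?_
        have hstep : st.step s N h (t, x) =
            { st with
              seen := Function.update seen t (seen t + 1)
              second := fun j => st.second j +
                if bucketOf st.recorded (h st.seed) x = j then streamSign t else 0 } := by
          rw [TesterState.step, if_neg (by omega), hst, if_neg hA, if_pos hB]
        rw [hE _ (by rw [hstep]; exact hs) (by rw [hstep]), sampleMean_const_mul]
        simp only [hstep, sketch, List.map_cons, List.sum_cons, add_assoc]
    · obtain ⟨σ₁, σ₂, hc1, hc2, hE⟩ := ih seen fun b => by
        by_cases hb : b = t
        · subst hb; omega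
        · have := hσ b
          rwa [List.count_cons_of_ne (Ne.symm hb)] at this
      refine ⟨σ₁, σ₂, hc1, hc2, fun st hs hst Φ => ?_⟩
      have hstep : ∀ x, st.step s N h (t, x) = st := fun x => by
        rw [TesterState.step, if_neg (by omega), hst, if_neg hA, if_neg hB]
      simp only [sampleMean, List.foldl_cons, hstep, ← Finset.sum_mul, h1, one_mul]
      exact hE st hs hst Φ

/-- The verdict of the tester: accept if the statistic stays below the threshold `θ`. -/
noncomputable def TesterState.accepts [Fintype B] (θ : ℝ) (st : TesterState Ω κ B) : Bool :=
  open Classical in decide (statistic (bucketWeight st.recorded) st.first st.second < θ)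

/-- The mean of a function of the verdict, over the samples and the seed, splits into means over the
recorded samples, the seed and the two batches. -/
theorem exists_sampleMean_foldl_eq [Fintype Ω] [Fintype B] (h1 : ∀ s, ∑ x, P s x = 1)
    {s N n : ℕ} (hn : s + 2 * N ≤ n) (h : Ω → κ → B) (σ : List Bool) (hσ : ∀ b, σ.count b = n)
    (θ : ℝ) (φ : Bool → ℝ) :
    ∃ ρ σ₁ σ₂ : List Bool, ρ.length = s ∧ (∀ b, σ₁.count b = N) ∧ (∀ b, σ₂.count b = N) ∧
      sampleMean P σ (fun xs => (∑ ω, φ ((xs.foldl (TesterState.step s N h)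
          (TesterState.start ω)).accepts θ)) / Fintype.card Ω) =
        sampleMean P ρ fun zs => (∑ ω, sampleMean P σ₁ fun xs => sampleMean P σ₂ fun ys =>
          φ (open Classical in decide (statistic (bucketWeight (zs.map Prod.snd).reverse)
            (sketch (bucketOf (zs.map Prod.snd).reverse (h ω)) xs)
            (sketch (bucketOf (zs.map Prod.snd).reverse (h ω)) ys) < θ))) / Fintype.card Ω := by
  have hlen : s ≤ σ.length := by
    have := (List.count_le_length (a := true) (l := σ))
    rw [hσ true] at this
    omega
  have hdrop : ∀ b, 2 * N ≤ 0 + (σ.drop s).count b := by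
    intro b
    have e : (σ.take s).count b + (σ.drop s).count b = n := by
      rw [← List.count_append, List.take_append_drop, hσ]
    have := (List.count_le_length (a := b) (l := σ.take s))
    rw [List.length_take] at this
    omega
  obtain ⟨σ₁, σ₂, hc1, hc2, hE⟩ := exists_batches h1 s N h (σ.drop s) (fun _ => 0) hdrop
  refine ⟨σ.take s, σ₁, σ₂, by simp [hlen], fun b => by rw [hc1]; omega,
    fun b => by rw [hc2]; omega, ?_⟩
  conv_lhs => rw [← List.take_append_drop s σ, sampleMean_append]
  refine sampleMean_congr _ fun zs hzs => ?_
  have hzl : zs.length = s := by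
    have := congrArg List.length hzs
    simpa [hlen] using this
  simp only [div_eq_inv_mul]
  rw [sampleMean_const_mul, sampleMean_sum]
  congr 1
  refine Finset.sum_congr rfl fun ω _ => ?_
  simp only [List.foldl_append]
  rw [foldl_step_of_length_le s N h zs (TesterState.start ω) (by simp [TesterState.start, hzl])]
  set st : TesterState Ω κ B := { TesterState.start ω with
    recorded := (zs.map Prod.snd).reverse ++ (TesterState.start (κ := κ) (B := B) ω).recorded }
    with hst
  have hrec : st.recorded = (zs.map Prod.snd).reverse := by simp [hst, TesterState.start]
  have hfix : ∀ (ys : List (Bool × κ)) (st' : TesterState Ω κ B), s ≤ st'.recorded.length →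
      (ys.foldl (TesterState.step s N h) st').recorded = st'.recorded := by
    intro ys
    induction ys with
    | nil => exact fun _ _ => rfl
    | cons y ys ih =>
      intro st' hs'
      have hstep : (st'.step s N h y).recorded = st'.recorded := by
        rw [TesterState.step, if_neg (by omega)]
        split_ifs <;> rfl
      rw [List.foldl_cons, ih _ (by rwa [hstep]), hstep]
  have hsl : s ≤ st.recorded.length := by rw [hrec]; simp [hzl]
  simp only [TesterState.accepts, hfix _ st hsl]
  rw [hE st hsl rfl fun u v => φ (open Classical in
    decide (statistic (bucketWeight st.recorded) u v < θ))]
  simp only [hrec]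
  simp [hst, TesterState.start]

end Tester

/-! ### Memory -/

section Memory

variable {Ω κ B : Type*}

/-- What holds of every state that the tester reaches: in particular, sketches vanish at the
elements that have not been recorded, so that these need no memory. -/
structure TesterState.Bounded (s N : ℕ) (st : TesterState Ω κ B) : Prop where
  recorded_le : st.recorded.length ≤ s
  seen_le : ∀ b, st.seen b ≤ 2 * N
  first_le : ∀ j, |st.first j| ≤ st.seen true + st.seen false
  second_le : ∀ j, |st.second j| ≤ st.seen true + st.seen false
  first_eq_zero : ∀ i, i ∉ st.recorded → st.first (.inl i) = 0
  second_eq_zero : ∀ i, i ∉ st.recorded → st.second (.inl i) = 0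

theorem TesterState.bounded_start (s N : ℕ) (ω : Ω) :
    (TesterState.start ω : TesterState Ω κ B).Bounded s N := by
  constructor <;> simp [TesterState.start]

theorem TesterState.Bounded.step [DecidableEq κ] [DecidableEq B] {s N : ℕ} (h : Ω → κ → B)
    {st : TesterState Ω κ B} (y : Bool × κ) (hst : st.Bounded s N) : (st.step s N h y).Bounded s N := by
  have habs : ∀ j : κ ⊕ B, |if bucketOf st.recorded (h st.seed) y.2 = j
      then streamSign y.1 else 0| ≤ 1 := by
    intro j
    split_ifs
    · unfold streamSign; split_ifs <;> simp
    · simp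
  have hzero : ∀ i, i ∉ st.recorded →
      (if bucketOf st.recorded (h st.seed) y.2 = .inl i then streamSign y.1 else 0) = 0 := by
    intro i hi
    rw [if_neg]
    unfold bucketOf
    split_ifs with hy
    · rintro ⟨⟩; exact hi hy
    · simp
  have hseen : ((Function.update st.seen y.1 (st.seen y.1 + 1) true : ℕ) : ℤ) +
      (Function.update st.seen y.1 (st.seen y.1 + 1) false : ℕ) =
      st.seen true + st.seen false + 1 := by
    rcases y with ⟨_ | _, x⟩ <;> simp <;> ring
  have hle : st.seen y.1 < 2 * N → ∀ b,
      Function.update st.seen y.1 (st.seen y.1 + 1) b ≤ 2 * N := by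
    intro hlt b
    by_cases hb : b = y.1
    · subst hb; rw [Function.update_self]; omega
    · rw [Function.update_of_ne hb]; exact hst.seen_le b
  unfold TesterState.step
  split_ifs with c1 c2 c3
  · refine ⟨c1, hst.seen_le, hst.first_le, hst.second_le, fun i hi => hst.first_eq_zero i ?_,
      fun i hi => hst.second_eq_zero i ?_⟩
    · exact fun h => hi (List.mem_cons_of_mem _ h)
    · exact fun h => hi (List.mem_cons_of_mem _ h)
  · refine ⟨hst.recorded_le, hle (by omega), fun j => ?_, fun j => ?_, fun i hi => ?_,
      hst.second_eq_zero⟩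
    · rw [hseen]
      exact (abs_add_le _ _).trans (add_le_add (hst.first_le j) (habs j))
    · rw [hseen]
      exact (hst.second_le j).trans (by omega)
    · exact (congrArg₂ _ (hst.first_eq_zero i hi) (hzero i hi)).trans (add_zero 0)
  · refine ⟨hst.recorded_le, hle c3, fun j => ?_, fun j => ?_, hst.first_eq_zero, fun i hi => ?_⟩
    · rw [hseen]
      exact (hst.first_le j).trans (by omega)
    · rw [hseen]
      exact (abs_add_le _ _).trans (add_le_add (hst.second_le j) (habs j))
    · exact (congrArg₂ _ (hst.second_eq_zero i hi) (hzero i hi)).trans (add_zero 0)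
  · exact hst

/-- The entries of a sketch that have to be stored: those of the recorded elements, by their place
in the record, and those of the hashed buckets. -/
def storedEntries (s : ℕ) (l : List κ) (u : κ ⊕ B → ℤ) : Fin s ⊕ B → ℤ :=
  Sum.elim (fun i => (l[(i : ℕ)]?).elim 0 fun x => u (.inl x)) fun b => u (.inr b)

theorem storedEntries_inj {s : ℕ} {l : List κ} (hl : l.length ≤ s) {u v : κ ⊕ B → ℤ}
    (hu : ∀ i, i ∉ l → u (.inl i) = 0) (hv : ∀ i, i ∉ l → v (.inl i) = 0)
    (h : storedEntries s l u = storedEntries s l v) : u = v := by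
  funext j
  rcases j with x | b
  · by_cases hx : x ∈ l
    · obtain ⟨i, hi, rfl⟩ := List.getElem_of_mem hx
      simpa [storedEntries, hi] using congrFun h (.inl ⟨i, hi.trans_le hl⟩)
    · rw [hu x hx, hv x hx]
  · exact congrFun h (.inr b)

/-- An integer of absolute value at most `M`, as a residue modulo `2 * M + 1`. -/
def boundedCode (M : ℕ) (z : ℤ) : Fin (2 * M + 1) := Fin.ofNat _ (z + M).toNat

theorem boundedCode_inj {M : ℕ} {y z : ℤ} (hy : |y| ≤ M) (hz : |z| ≤ M)
    (h : boundedCode M y = boundedCode M z) : y = z := by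
  rw [abs_le] at hy hz
  have := congrArg Fin.val h
  simp only [boundedCode, Fin.ofNat] at this
  rw [Nat.mod_eq_of_lt (by omega), Nat.mod_eq_of_lt (by omega)] at this
  omega

/-- The contents of the memory in a given state. -/
def TesterState.encode (s N : ℕ) (st : TesterState Ω κ B) :
    Ω × (Fin s → Option κ) × (Bool → Fin (2 * N + 1)) ×
      (Fin s ⊕ B → Fin (2 * (4 * N) + 1)) × (Fin s ⊕ B → Fin (2 * (4 * N) + 1)) :=
  (st.seed, fun i => st.recorded[(i : ℕ)]?, fun b => Fin.ofNat _ (st.seen b),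
    fun j => boundedCode _ (storedEntries s st.recorded st.first j),
    fun j => boundedCode _ (storedEntries s st.recorded st.second j))

theorem TesterState.injOn_encode (s N : ℕ) :
    Set.InjOn (TesterState.encode s N) {st : TesterState Ω κ B | st.Bounded s N} := by
  intro st hst st' hst' h
  simp only [TesterState.encode, Prod.mk.injEq] at h
  obtain ⟨h1, h2, h3, h4, h5⟩ := h
  have hrec : st.recorded = st'.recorded := by
    refine List.ext_getElem? fun i => ?_
    by_cases hi : i < s
    · exact congrFun h2 ⟨i, hi⟩
    · rw [List.getElem?_eq_none (hst.recorded_le.trans (not_lt.1 hi)),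
        List.getElem?_eq_none (hst'.recorded_le.trans (not_lt.1 hi))]
  have hseen : st.seen = st'.seen := by
    funext b
    have := congrArg Fin.val (congrFun h3 b)
    simp only [Fin.ofNat] at this
    rwa [Nat.mod_eq_of_lt (Nat.lt_succ_of_le (hst.seen_le b)),
      Nat.mod_eq_of_lt (Nat.lt_succ_of_le (hst'.seen_le b))] at this
  have hbound : ∀ (l : List κ) (u : κ ⊕ B → ℤ), (∀ j, |u j| ≤ (4 * N : ℕ)) →
      ∀ j, |storedEntries s l u j| ≤ (4 * N : ℕ) := by
    intro l u hu j
    rcases j with i | b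
    · simp only [storedEntries, Sum.elim_inl]
      cases l[(i : ℕ)]? with
      | none => simp
      | some x => exact hu _
    · exact hu _
  have h4N : ∀ st'' : TesterState Ω κ B, st''.Bounded s N →
      ((st''.seen true : ℤ) + st''.seen false ≤ (4 * N : ℕ)) := by
    intro st'' hb
    have := hb.seen_le true
    have := hb.seen_le false
    omega
  have key : ∀ u v : κ ⊕ B → ℤ, (∀ j, |u j| ≤ (4 * N : ℕ)) → (∀ j, |v j| ≤ (4 * N : ℕ)) →
      (∀ i, i ∉ st.recorded → u (.inl i) = 0) → (∀ i, i ∉ st.recorded → v (.inl i) = 0) →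
      ((fun j => boundedCode (4 * N) (storedEntries s st.recorded u j)) =
        fun j => boundedCode (4 * N) (storedEntries s st.recorded v j)) → u = v := by
    intro u v hu hv hu0 hv0 huv
    refine storedEntries_inj hst.recorded_le hu0 hv0 (funext fun j => ?_)
    exact boundedCode_inj (hbound _ _ hu j) (hbound _ _ hv j) (congrFun huv j)
  rw [← hrec] at h4 h5
  refine TesterState.ext h1 hrec hseen ?_ ?_
  · exact key _ _ (fun j => (hst.first_le j).trans (h4N _ hst))
      (fun j => (hst'.first_le j).trans (h4N _ hst')) hst.first_eq_zero
      (hrec ▸ hst'.first_eq_zero) h4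
  · exact key _ _ (fun j => (hst.second_le j).trans (h4N _ hst))
      (fun j => (hst'.second_le j).trans (h4N _ hst')) hst.second_eq_zero
      (hrec ▸ hst'.second_eq_zero) h5

end Memory

/-! ### Correctness of the tester -/

section Correctness

variable {Ω κ B : Type*} [Fintype Ω] [Fintype κ] [DecidableEq κ] [Fintype B] [DecidableEq B]
  {P : Bool → κ → ℝ}

/-- One of the two streams provides at least half of a list of samples. -/
theorem exists_length_le_two_mul_count (ρ : List Bool) : ∃ b, ρ.length ≤ 2 * ρ.count b := by
  have := List.count_false_add_count_true ρ
  by_cases h : ρ.length ≤ 2 * ρ.count true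
  · exact ⟨true, h⟩
  · exact ⟨false, by omega⟩

/-- The weighted squared norm of the law of the stream that provides most records, on average over
the records and the hash functions. -/
theorem exists_sampleMean_norm_le [Nonempty Ω] (h1 : ∀ s, ∑ x, P s x = 1)
    (h0 : ∀ s x, 0 ≤ P s x) {h : Ω → κ → B} (hh : IsPairHash h) {ρ : List Bool}
    (hρ : 0 < ρ.length) :
    ∃ b, sampleMean P ρ (fun zs => (∑ ω, ∑ j,
        bucketMass (P b) (bucketOf (zs.map Prod.snd).reverse (h ω)) j ^ 2 /
          bucketWeight (zs.map Prod.snd).reverse j ^ 2) / Fintype.card Ω) ≤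
      4 / ρ.length + 1 / Fintype.card B := by
  obtain ⟨b, hb⟩ := exists_length_le_two_mul_count ρ
  refine ⟨b, ?_⟩
  have hΩ : (0 : ℝ) < Fintype.card Ω := by exact_mod_cast Fintype.card_pos
  have hc : 0 < ρ.count b := by omega
  have hρ' : (0 : ℝ) < ρ.length := by exact_mod_cast hρ
  have hb' : (ρ.length : ℝ) ≤ 2 * ρ.count b := by exact_mod_cast hb
  calc _ ≤ sampleMean P ρ (fun zs =>
        ∑ i, P b i ^ 2 / (1 + (zs.map Prod.snd).count i : ℝ) ^ 2 + 1 / Fintype.card B) := by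
        refine sampleMean_mono h0 ρ fun zs => ?_
        rw [div_le_iff₀ hΩ]
        have := sum_sum_bucketMass_sq_div_le hh (zs.map Prod.snd).reverse (h0 b) (h1 b)
        simp only [List.count_reverse] at this
        linarith
    _ ≤ 2 / ρ.count b + 1 / Fintype.card B := by
        rw [sampleMean_add, sampleMean_const h1]
        gcongr
        exact sampleMean_sum_sq_div_count_le h1 h0 b ρ hc
    _ ≤ 4 / ρ.length + 1 / Fintype.card B := by
        gcongr ?_ + _
        rw [div_le_div_iff₀ (by exact_mod_cast hc) hρ']
        linarith

variable {N : ℕ} {β : ℝ} {ρ σ τ : List Bool}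

/-- Two equal laws are rejected with probability at most `1 / 3`, over the records, the hash
functions and the two batches. -/
theorem sampleMean_reject_le [Nonempty Ω] (h1 : ∀ s, ∑ x, P s x = 1)
    (h0 : ∀ s x, 0 ≤ P s x) {h : Ω → κ → B} (hh : IsPairHash h) (hρ : 0 < ρ.length)
    (hσ : ∀ b, σ.count b = N) (hτ : ∀ b, τ.count b = N) (hN : 0 < N) (hβ : 0 < β)
    (hreq : 10 ^ 5 * (4 / ρ.length + 1 / Fintype.card B) ≤ (N : ℝ) ^ 2 * β ^ 2)
    (hP : P true = P false) :
    sampleMean P ρ (fun zs => (∑ ω, sampleMean P σ fun xs => sampleMean P τ fun ys =>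
      if N ^ 2 * β / 2 ≤ statistic (bucketWeight (zs.map Prod.snd).reverse)
        (sketch (bucketOf (zs.map Prod.snd).reverse (h ω)) xs)
        (sketch (bucketOf (zs.map Prod.snd).reverse (h ω)) ys) then 1 else 0) /
          Fintype.card Ω) ≤ 1 / 3 := by
  obtain ⟨b, hb⟩ := exists_sampleMean_norm_le h1 h0 hh hρ
  have hΩ : (0 : ℝ) < Fintype.card Ω := by exact_mod_cast Fintype.card_pos
  have hN' : (0 : ℝ) < N := by exact_mod_cast hN
  have hθ : 0 < N ^ 2 * β / 2 := by positivity
  calc _ ≤ sampleMean P ρ (fun zs => 4 * N ^ 2 / (N ^ 2 * β / 2) ^ 2 * ((∑ ω, ∑ j,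
        bucketMass (P b) (bucketOf (zs.map Prod.snd).reverse (h ω)) j ^ 2 /
          bucketWeight (zs.map Prod.snd).reverse j ^ 2) / Fintype.card Ω)) := by
        refine sampleMean_mono h0 ρ fun zs => ?_
        rw [← mul_div_assoc, Finset.mul_sum]
        gcongr with ω
        exact sampleMean_le_statistic_le h1 h0 hP (hσ _) (hσ _) (hτ _) (hτ _) _ _ hθ b
    _ ≤ 4 * N ^ 2 / (N ^ 2 * β / 2) ^ 2 * (4 / ρ.length + 1 / Fintype.card B) := by
        rw [sampleMean_const_mul]
        gcongr
    _ ≤ 4 * N ^ 2 / (N ^ 2 * β / 2) ^ 2 * (N ^ 2 * β ^ 2 / 10 ^ 5) := by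
        gcongr
        linarith
    _ ≤ 1 / 3 := by
        field_simp
        norm_num

/-- Two distant laws are accepted with probability at most `1 / 3`.  The distance enters through the
squared norm of the difference that is weighted by the record, before hashing. -/
theorem sampleMean_accept_le [Nonempty Ω] [Nonempty B] (h1 : ∀ s, ∑ x, P s x = 1)
    (h0 : ∀ s x, 0 ≤ P s x) {h : Ω → κ → B} (hh : IsPairHash h) (hB : 256 ≤ Fintype.card B)
    (hρ : 0 < ρ.length)
    (hσ : ∀ b, σ.count b = N) (hτ : ∀ b, τ.count b = N) (hN : 0 < N) (hβ : 0 < β)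
    (hreq : 10 ^ 5 * (4 / ρ.length + 1 / Fintype.card B) ≤ (N : ℝ) ^ 2 * β ^ 2)
    (hreq' : 10 ^ 5 ≤ (N : ℝ) ^ 2 * β)
    (hfar : ∀ l : List κ, l.length = ρ.length →
      2 * β ≤ ∑ i, (P true i - P false i) ^ 2 / (1 + l.count i : ℝ)) :
    sampleMean P ρ (fun zs => (∑ ω, sampleMean P σ fun xs => sampleMean P τ fun ys =>
      if statistic (bucketWeight (zs.map Prod.snd).reverse)
        (sketch (bucketOf (zs.map Prod.snd).reverse (h ω)) xs)
        (sketch (bucketOf (zs.map Prod.snd).reverse (h ω)) ys) < N ^ 2 * β / 2 then 1 else 0) /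
          Fintype.card Ω) ≤ 1 / 3 := by
  obtain ⟨b, hb⟩ := exists_sampleMean_norm_le h1 h0 hh hρ
  have hΩ : (0 : ℝ) < Fintype.card Ω := by exact_mod_cast Fintype.card_pos
  have hN' : (0 : ℝ) < N := by exact_mod_cast hN
  let Q : List (Bool × κ) → Ω → ℝ := fun zs ω => ∑ j,
    bucketMass (P b) (bucketOf (zs.map Prod.snd).reverse (h ω)) j ^ 2 /
      bucketWeight (zs.map Prod.snd).reverse j ^ 2
  let Δ : List (Bool × κ) → Ω → ℝ := fun zs ω => ∑ j,
    bucketMass (fun x => P true x - P false x) (bucketOf (zs.map Prod.snd).reverse (h ω)) j ^ 2 /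
      bucketWeight (zs.map Prod.snd).reverse j
  have hQ0 : ∀ zs ω, 0 ≤ Q zs ω := fun zs ω => Finset.sum_nonneg fun j _ => by positivity
  have hsub : ∀ (g : κ → κ ⊕ B) j, bucketMass (P true) g j - bucketMass (P false) g j =
      bucketMass (fun x => P true x - P false x) g j := by
    intro g j
    simp only [bucketMass, ← Finset.sum_sub_distrib]
    exact Finset.sum_congr rfl fun x _ => by split_ifs <;> simp
  -- a bad seed, for which the two laws come close, is simply counted as a failure
  have hpt : ∀ zs ω, (sampleMean P σ fun xs => sampleMean P τ fun ys =>
      if statistic (bucketWeight (zs.map Prod.snd).reverse)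
        (sketch (bucketOf (zs.map Prod.snd).reverse (h ω)) xs)
        (sketch (bucketOf (zs.map Prod.snd).reverse (h ω)) ys) < N ^ 2 * β / 2 then 1 else 0) ≤
      3232 / (N ^ 2 * β ^ 2) * Q zs ω + (808 / (N ^ 2 * β) + 1 / 25) +
        if Δ zs ω < 2 * β / 2 then 1 else 0 := by
    intro zs ω
    have hQ' : 0 ≤ 3232 / (N ^ 2 * β ^ 2) * Q zs ω + (808 / (N ^ 2 * β) + 1 / 25) :=
      add_nonneg (mul_nonneg (by positivity) (hQ0 zs ω)) (by positivity)
    by_cases hbad : Δ zs ω < 2 * β / 2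
    · rw [if_pos hbad]
      refine le_trans ?_ (le_add_of_nonneg_left hQ')
      exact (sampleMean_mono h0 σ fun xs => (sampleMean_mono h0 τ (G := fun _ => 1) fun ys => by
        split_ifs <;> norm_num).trans_eq (sampleMean_const h1 τ 1)).trans_eq
          (sampleMean_const h1 σ 1)
    · rw [if_neg hbad, add_zero, ← add_assoc]
      refine sampleMean_statistic_lt_le h1 h0 hN (hσ _) (hσ _) (hτ _) (hτ _) _
        (one_le_bucketWeight _) b hβ ?_
      simp only [hsub]
      change β ≤ Δ zs ω
      linarith
  calc _ ≤ sampleMean P ρ (fun zs => 3232 / (N ^ 2 * β ^ 2) * ((∑ ω, Q zs ω) / Fintype.card Ω) +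
          (808 / (N ^ 2 * β) + 1 / 25 + 1 / 8)) := by
        refine sampleMean_mono_of_map h0 ρ fun zs hzs => ?_
        have hl : (zs.map Prod.snd).reverse.length = ρ.length := by rw [← hzs]; simp
        have hbad := sum_sum_bucketMass_sq_div_lt_le hB hh _ _ (by positivity) (hfar _ hl)
        rw [div_le_iff₀ hΩ]
        refine (Finset.sum_le_sum fun ω _ => hpt zs ω).trans ?_
        rw [Finset.sum_add_distrib, Finset.sum_add_distrib, ← Finset.mul_sum, Finset.sum_const,
          Finset.card_univ, nsmul_eq_mul, add_mul, mul_assoc _ (_ / _), div_mul_cancel₀ _ hΩ.ne']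
        linarith
    _ ≤ 3232 / (N ^ 2 * β ^ 2) * (4 / ρ.length + 1 / Fintype.card B) +
          (808 / (N ^ 2 * β) + 1 / 25 + 1 / 8) := by
        rw [sampleMean_add, sampleMean_const_mul, sampleMean_const h1]
        gcongr
    _ ≤ 3232 / (N ^ 2 * β ^ 2) * (N ^ 2 * β ^ 2 / 10 ^ 5) +
          (808 / 10 ^ 5 + 1 / 25 + 1 / 8) := by
        gcongr
        linarith
    _ ≤ 1 / 3 := by
        have : 3232 / (N ^ 2 * β ^ 2) * (N ^ 2 * β ^ 2 / 10 ^ 5) = (3232 / 10 ^ 5 : ℝ) := by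
          field_simp
        rw [this]
        norm_num

end Correctness

/-- The tester, for explicit sizes of the record and of the batches. -/
theorem exists_testsCloseness {k s N n e t w b : ℕ} {ε : ℝ} (hk : 0 < k) (hε0 : 0 < ε)
    (hε1 : ε ≤ 1) (hs : 0 < s) (hsk : s ≤ k) (hN : 0 < N)
    (hreq : 500000 * (k : ℝ) ^ 2 ≤ N ^ 2 * ε ^ 4 * s) (hn : s + 2 * N ≤ n) (he : 8 ≤ e)
    (hse : s ≤ 2 ^ e) (hkt : k ≤ 2 ^ t) (het : e ≤ t) (hNw : 8 * N + 1 ≤ 2 ^ w)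
    (hkw : k + 1 ≤ 2 ^ w) (hb : 4 * t + w * (s + 2 + 2 * (s + 2 ^ e)) ≤ b) :
    ∃ A : StreamAlg k b, A.TestsCloseness n ε := by
  classical
  obtain ⟨Ω, _, _, h, hΩ, hh⟩ := exists_isPairHash hkt het (by omega : t ≠ 0)
  have hk' : (0 : ℝ) < k := by exact_mod_cast hk
  have hs' : (0 : ℝ) < s := by exact_mod_cast hs
  have hN' : (0 : ℝ) < N := by exact_mod_cast hN
  have hsk' : (s : ℝ) ≤ k := by exact_mod_cast hsk
  have hcardB : Fintype.card (Fin e → ZMod 2) = 2 ^ e := by simp [ZMod.card]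
  have hB256 : 256 ≤ Fintype.card (Fin e → ZMod 2) := by
    rw [hcardB]
    exact (by norm_num : 256 = 2 ^ 8) ▸ Nat.pow_le_pow_right two_pos he
  obtain ⟨β, hβ⟩ : ∃ β, β = ε ^ 2 / k := ⟨_, rfl⟩
  have hβ0 : 0 < β := by rw [hβ]; positivity
  have hreq1 : 10 ^ 5 * (4 / s + 1 / Fintype.card (Fin e → ZMod 2)) ≤ (N : ℝ) ^ 2 * β ^ 2 := by
    have hse' : (s : ℝ) ≤ Fintype.card (Fin e → ZMod 2) := by rw [hcardB]; exact_mod_cast hse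
    calc _ ≤ 10 ^ 5 * (4 / s + 1 / (s : ℝ)) := by gcongr
      _ = 500000 * (k : ℝ) ^ 2 / (k ^ 2 * s) := by field_simp; norm_num
      _ ≤ N ^ 2 * ε ^ 4 * s / (k ^ 2 * s) := by gcongr
      _ = N ^ 2 * β ^ 2 := by rw [hβ]; field_simp
  have hreq2 : 10 ^ 5 ≤ (N : ℝ) ^ 2 * β := by
    have hε2 : ε ^ 2 ≤ 1 := pow_le_one₀ hε0.le hε1
    have hle : ε ^ 2 * s ≤ k := by nlinarith
    have e1 : (N : ℝ) ^ 2 * β * k ^ 2 = N ^ 2 * ε ^ 2 * k := by rw [hβ]; field_simp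
    have : (10 : ℝ) ^ 5 * k ^ 2 ≤ N ^ 2 * β * k ^ 2 := by
      rw [e1]
      have := mul_le_mul_of_nonneg_left hle (by positivity : 0 ≤ (N : ℝ) ^ 2 * ε ^ 2)
      nlinarith [sq_nonneg (k : ℝ)]
    exact le_of_mul_le_mul_right this (by positivity)
  have hcard : Fintype.card (Ω × (Fin s → Option (Fin k)) × (Bool → Fin (2 * N + 1)) ×
      (Fin s ⊕ (Fin e → ZMod 2) → Fin (2 * (4 * N) + 1)) ×
      (Fin s ⊕ (Fin e → ZMod 2) → Fin (2 * (4 * N) + 1))) ≤ 2 ^ b := by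
    simp only [Fintype.card_prod, Fintype.card_fun, Fintype.card_sum, Fintype.card_option,
      Fintype.card_fin, Fintype.card_bool, hΩ, ZMod.card]
    calc _ ≤ 2 ^ (4 * t) * ((2 ^ w) ^ s * ((2 ^ w) ^ 2 *
          ((2 ^ w) ^ (s + 2 ^ e) * (2 ^ w) ^ (s + 2 ^ e)))) := by
          gcongr <;> omega
      _ = 2 ^ (4 * t + w * (s + 2 + 2 * (s + 2 ^ e))) := by ring
      _ ≤ 2 ^ b := Nat.pow_le_pow_right two_pos hb
  obtain ⟨A, hA⟩ := exists_streamAlg_of_machine (TesterState.step s N h) TesterState.start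
    (TesterState.accepts (N ^ 2 * β / 2)) (TesterState.Bounded s N)
    (TesterState.bounded_start s N) (fun _ y hst => hst.step h y) (TesterState.encode s N)
    (TesterState.injOn_encode s N) hcard
  refine ⟨A, fun p q σ hσt hσf => ?_⟩
  have hσ : ∀ b, σ.count b = n := fun b => by cases b <;> assumption
  set P : Bool → Fin k → ℝ := fun s x => ((if s then p else q) x).toReal with hP
  have h1 : ∀ s, ∑ x, P s x = 1 := fun s => sum_toReal_eq_one _
  have h0 : ∀ s x, 0 ≤ P s x := fun s x => ENNReal.toReal_nonneg
  have hlaw : ∀ v, (A.verdictLaw p q σ v).toReal = sampleMean P σ (fun xs =>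
      (∑ ω, if (xs.foldl (TesterState.step s N h) (TesterState.start ω)).accepts
        (N ^ 2 * β / 2) = v then 1 else 0) / Fintype.card Ω) := by
    intro v
    rw [toReal_verdictLaw]
    simp only [hA, hP]
  have hsum : (A.verdictLaw p q σ true).toReal + (A.verdictLaw p q σ false).toReal = 1 := by
    have := (A.verdictLaw p q σ).tsum_coe
    rw [tsum_bool, add_comm] at this
    rw [← ENNReal.toReal_add (PMF.apply_ne_top _ _) (PMF.apply_ne_top _ _), this,
      ENNReal.toReal_one]
  refine ⟨fun hpq => ?_, fun hfar => ?_⟩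
  · have hfail : (A.verdictLaw p q σ false).toReal ≤ 1 / 3 := by
      obtain ⟨ρ, σ₁, σ₂, hρ, hσ₁, hσ₂, hE⟩ := exists_sampleMean_foldl_eq h1 hn h σ hσ
        (N ^ 2 * β / 2) fun v => if v = false then 1 else 0
      rw [hlaw, hE]
      simp only [decide_eq_false_iff_not, not_lt]
      refine sampleMean_reject_le h1 h0 hh (hρ ▸ hs) hσ₁ hσ₂ hN hβ0 (hρ ▸ hreq1) ?_
      simp [hP, hpq]
    linarith
  · have hfail : (A.verdictLaw p q σ true).toReal ≤ 1 / 3 := by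
      obtain ⟨ρ, σ₁, σ₂, hρ, hσ₁, hσ₂, hE⟩ := exists_sampleMean_foldl_eq h1 hn h σ hσ
        (N ^ 2 * β / 2) fun v => if v = true then 1 else 0
      rw [hlaw, hE]
      simp only [decide_eq_true_eq]
      refine sampleMean_accept_le h1 h0 hh hB256 (hρ ▸ hs) hσ₁ hσ₂ hN hβ0 (hρ ▸ hreq1) hreq2
        fun l hl => ?_
      have hcs := sq_sum_abs_div_le l fun i => P true i - P false i
      rw [hl, hρ, Fintype.card_fin] at hcs
      have htv : 2 * ε ≤ ∑ i, |P true i - P false i| := by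
        have : tvDist p q = 1 / 2 * ∑ i, |P true i - P false i| := by simp [tvDist, hP]
        linarith
      have hsq : (2 * ε) ^ 2 ≤ (∑ i, |P true i - P false i|) ^ 2 :=
        pow_le_pow_left₀ (by positivity) htv 2
      set S := ∑ i, (P true i - P false i) ^ 2 / (1 + l.count i : ℝ) with hS
      have hS0 : 0 ≤ S := Finset.sum_nonneg fun i _ => by positivity
      have hle : S * (k + s) ≤ S * (2 * k) := by gcongr; linarith
      rw [hβ, ← mul_div_assoc, div_le_iff₀ hk']
      linarith
    linarith

/-! ### Choice of the parameters -/

/-- If the domain has at most one element, there is nothing to test. -/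
theorem exists_testsCloseness_of_le_one {k : ℕ} (hk : k ≤ 1) (b n : ℕ) {ε : ℝ} (hε : 0 < ε) :
    ∃ A : StreamAlg k b, A.TestsCloseness n ε := by
  have hsub : Subsingleton (Fin k) := Fin.subsingleton_iff_le_one.2 hk
  let A : StreamAlg k b :=
    ⟨PMF.pure fun _ => false, fun s _ => PMF.pure s, fun _ => true⟩
  have hv : ∀ xs, A.verdict xs = PMF.pure true := fun xs => PMF.map_const _ true
  refine ⟨A, fun p q σ _ _ => ⟨fun _ => ?_, fun hfar => ?_⟩⟩
  · have : A.verdictLaw p q σ = PMF.pure true := by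
      rw [StreamAlg.verdictLaw, funext hv]
      exact PMF.bind_const _ _
    rw [this]
    norm_num
  · have hone : ∀ (r : PMF (Fin k)) i, (r i).toReal = 1 := fun r i => by
      rw [← sum_toReal_eq_one r, Fintype.sum_subsingleton _ i]
    simp only [tvDist, hone, sub_self, abs_zero, Finset.sum_const_zero, mul_zero] at hfar
    exact absurd hfar hε.not_gt

/-- A stream so long that even its length cannot be stored: finitely many of its samples, a number
that can be counted, suffice. -/
theorem exists_testsCloseness_of_long_stream {k n m : ℕ} {ε : ℝ} (hk : 0 < k) (hm : 0 < m)
    (hε0 : 0 < ε) (hε1 : ε ≤ 1) (hkm : k ≤ 2 ^ m) (hεm : 1 ≤ ε * 2 ^ m) (hn : 2 ^ (15 * m) < n) :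
    ∃ A : StreamAlg k (60000 * m), A.TestsCloseness n ε := by
  obtain ⟨N, hN⟩ : ∃ N, 4 * N = 2 ^ (15 * m) :=
    ⟨2 ^ (15 * m - 2), by
      rw [show 4 = 2 ^ 2 by norm_num, ← pow_add]
      congr 1
      omega⟩
  have hpos : 0 < 2 ^ (15 * m) := by positivity
  refine exists_testsCloseness (s := 1) (N := N) (e := 8) (t := m + 8) (w := 15 * m + 2) hk hε0 hε1
    one_pos hk (by omega) ?_ (by omega) le_rfl (by norm_num)
    (hkm.trans (Nat.pow_le_pow_right two_pos (by omega))) (by omega) ?_ ?_ (by norm_num; omega)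
  · have hN' : 4 * (N : ℝ) = (2 ^ m) ^ 15 := by
      rw [← pow_mul, mul_comm m]
      exact_mod_cast hN
    have hkx : (k : ℝ) ≤ 2 ^ m := by exact_mod_cast hkm
    have hx2 : (2 : ℝ) ≤ 2 ^ m := by
      simpa using pow_le_pow_right₀ (one_le_two : (1 : ℝ) ≤ 2) hm
    generalize (2 : ℝ) ^ m = x at *
    have hx0 : 0 < x := by linarith
    have h24 : (2 : ℝ) ^ 24 ≤ x ^ 24 := pow_le_pow_left₀ two_pos.le hx2 24
    calc 500000 * (k : ℝ) ^ 2 ≤ 2 ^ 24 / 16 * x ^ 2 * 1 ^ 4 := by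
          have : (k : ℝ) ^ 2 ≤ x ^ 2 := pow_le_pow_left₀ (Nat.cast_nonneg k) hkx 2
          nlinarith
      _ ≤ x ^ 24 / 16 * x ^ 2 * (ε * x) ^ 4 := by gcongr
      _ = ((x ^ 15) / 4) ^ 2 * ε ^ 4 := by ring
      _ = N ^ 2 * ε ^ 4 * (1 : ℕ) := by rw [← hN']; push_cast; ring
  · rw [pow_add]
    omega
  · calc k + 1 ≤ 2 ^ m + 2 ^ m := add_le_add hkm Nat.one_le_two_pow
      _ = 2 ^ (m + 1) := by ring
      _ ≤ 2 ^ (15 * m + 2) := Nat.pow_le_pow_right two_pos (by omega)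

/-- A stream whose length can be stored: about `m / log n` samples are recorded, and the remaining
elements are hashed into as many buckets, up to constants. -/
theorem exists_testsCloseness_of_short_stream {k n m : ℕ} {ε : ℝ} (hk : 0 < k) (hm : 0 < m)
    (hε0 : 0 < ε) (hε1 : ε ≤ 1) (hkm : k ≤ 2 ^ m) (hn : n ≤ 2 ^ (15 * m))
    (hmk : (m : ℝ) ≤ k * Real.logb 2 n)
    (h1 : 10 ^ 8 * (k : ℝ) ^ 2 * Real.logb 2 n ≤ n ^ 2 * ε ^ 4 * m)
    (h2 : 10 ^ 12 * (k : ℝ) ^ 2 ≤ n ^ 3 * ε ^ 4) :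
    ∃ A : StreamAlg k (60000 * m), A.TestsCloseness n ε := by
  have hk1 : (1 : ℝ) ≤ k := by exact_mod_cast hk
  have hε4 : ε ^ 4 ≤ 1 := pow_le_one₀ hε0.le hε1
  have h3 : 10 ^ 12 * (k : ℝ) ^ 2 ≤ (n : ℝ) ^ 3 :=
    h2.trans (mul_le_of_le_one_right (by positivity) hε4)
  have hn4 : 10000 ≤ n := by
    have : (10000 : ℝ) ^ 3 ≤ n ^ 3 := by nlinarith
    exact_mod_cast (pow_le_pow_iff_left₀ (by norm_num) (Nat.cast_nonneg n) three_ne_zero).1 this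
  obtain ⟨q, hq⟩ : ∃ q, q = Nat.log 2 n := ⟨_, rfl⟩
  have hqn : 2 ^ q ≤ n := hq ▸ Nat.pow_log_le_self 2 (by omega)
  have hnq : n < 2 ^ (q + 1) := hq ▸ Nat.lt_pow_succ_log_self one_lt_two n
  have hq13 : 13 ≤ q := by
    rw [hq]
    exact Nat.le_log_of_pow_le one_lt_two (by omega)
  have hqm : q ≤ 15 * m := (Nat.pow_le_pow_iff_right one_lt_two).1 (hqn.trans hn)
  have hn0 : (0 : ℝ) < n := by exact_mod_cast (by omega : 0 < n)
  obtain ⟨L, hL⟩ : ∃ L, L = Real.logb 2 n := ⟨_, rfl⟩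
  have hqL : (q : ℝ) ≤ L := by
    rw [hL, Real.le_logb_iff_rpow_le one_lt_two hn0, Real.rpow_natCast]
    exact_mod_cast hqn
  have hL0 : 0 < L := lt_of_lt_of_le (by exact_mod_cast (by omega : 0 < q)) hqL
  rw [← hL] at hmk h1
  obtain ⟨M, hM⟩ : ∃ M, M = m / q + 1 := ⟨_, rfl⟩
  have hMq : M * q ≤ 16 * m := by
    have := Nat.div_mul_le_self m q
    rw [hM, add_mul]
    omega
  have hmM : (m : ℝ) ≤ M * L := by
    have : m < M * q := by
      rw [hM, mul_comm]
      exact Nat.lt_mul_div_succ m (by omega)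
    have h' : (m : ℝ) ≤ M * q := by exact_mod_cast this.le
    exact h'.trans (mul_le_mul_of_nonneg_left hqL (Nat.cast_nonneg M))
  obtain ⟨s, hs⟩ : ∃ s, s = min k (min (n / 4) M) := ⟨_, rfl⟩
  obtain ⟨e, he⟩ : ∃ e, e = 8 + Nat.log 2 M := ⟨_, rfl⟩
  have hM0 : M ≠ 0 := hM ▸ Nat.succ_ne_zero _
  have heM : 2 ^ e ≤ 256 * M := by
    have := Nat.pow_log_le_self 2 hM0
    rw [he, pow_add]
    omega
  have hMe : 128 * M ≤ 2 ^ e := by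
    have := Nat.lt_pow_succ_log_self one_lt_two M
    rw [pow_succ] at this
    rw [he, pow_add]
    omega
  have hee : e < 2 ^ e := Nat.lt_two_pow_self
  have hsM : s ≤ M := by omega
  refine exists_testsCloseness (s := s) (N := n / 4) (e := e) (t := e + m) (w := 2 * (q + 1)) hk
    hε0 hε1 (by omega) (by omega) (by omega) ?_ (by omega) (by omega) (by omega)
    (hkm.trans (Nat.pow_le_pow_right two_pos (by omega))) (by omega) ?_ ?_ ?_
  · have hN8 : (n : ℝ) / 8 ≤ (n / 4 : ℕ) := by
      rw [div_le_iff₀ (by norm_num)]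
      exact_mod_cast (by omega : n ≤ n / 4 * 8)
    -- the record is as long as the memory, the domain and the stream permit
    have hcase : 10 ^ 8 * (k : ℝ) ^ 2 ≤ n ^ 2 * ε ^ 4 * s := by
      have hlarge : (m : ℝ) ≤ s * L → 10 ^ 8 * (k : ℝ) ^ 2 ≤ n ^ 2 * ε ^ 4 * s := by
        intro hms
        refine le_of_mul_le_mul_right ?_ hL0
        calc _ ≤ n ^ 2 * ε ^ 4 * m := h1
          _ ≤ n ^ 2 * ε ^ 4 * (s * L) := by gcongr
          _ = _ := by ring
      rcases (by omega : s = k ∨ s = n / 4 ∨ s = M) with h | h | h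
      · exact hlarge (h ▸ hmk)
      · rw [h]
        calc 10 ^ 8 * (k : ℝ) ^ 2 ≤ 10 ^ 12 * (k : ℝ) ^ 2 / 8 := by
              nlinarith [sq_nonneg (k : ℝ)]
          _ ≤ n ^ 3 * ε ^ 4 / 8 := by gcongr
          _ = n ^ 2 * ε ^ 4 * (n / 8) := by ring
          _ ≤ _ := by gcongr
      · exact hlarge (h ▸ hmM)
    calc 500000 * (k : ℝ) ^ 2 ≤ 10 ^ 8 * (k : ℝ) ^ 2 / 64 := by nlinarith [sq_nonneg (k : ℝ)]
      _ ≤ n ^ 2 * ε ^ 4 * s / 64 := by gcongr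
      _ = (n / 8 : ℝ) ^ 2 * ε ^ 4 * s := by ring
      _ ≤ _ := by gcongr
  · have hsq : n * n ≤ 2 ^ (2 * (q + 1)) := by
      rw [two_mul, pow_add]
      exact Nat.mul_le_mul hnq.le hnq.le
    have : 4 * n ≤ n * n := Nat.mul_le_mul_right n (by omega)
    omega
  · have hsq : n ^ 2 ≤ 2 ^ (2 * (q + 1)) := by
      rw [mul_comm, pow_mul]
      exact Nat.pow_le_pow_left hnq.le 2
    refine le_trans ?_ hsq
    have hn1 : (1 : ℝ) ≤ n := by exact_mod_cast (by omega : 1 ≤ n)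
    have : ((k + 1 : ℕ) : ℝ) ^ 2 ≤ ((n ^ 2 : ℕ) : ℝ) ^ 2 := by
      push_cast
      have : (n : ℝ) ^ 3 ≤ ((n : ℝ) ^ 2) ^ 2 := by
        rw [← pow_mul]
        exact pow_le_pow_right₀ hn1 (by norm_num)
      nlinarith
    exact_mod_cast (pow_le_pow_iff_left₀ (Nat.cast_nonneg _) (Nat.cast_nonneg _) two_ne_zero).1 this
  · have hr : s + 2 + 2 * (s + 2 ^ e) ≤ 3 * 2 ^ e := by omega
    calc 4 * (e + m) + 2 * (q + 1) * (s + 2 + 2 * (s + 2 ^ e))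
        ≤ 4 * (2 ^ e * q + m) + 3 * q * (3 * 2 ^ e) := by
          have he' : e ≤ 2 ^ e * q := hee.le.trans (Nat.le_mul_of_pos_right _ (by omega))
          have hw : 2 * (q + 1) ≤ 3 * q := by omega
          gcongr
      _ = 4 * m + 13 * (2 ^ e * q) := by ring
      _ ≤ 4 * m + 13 * (256 * M * q) := by gcongr
      _ = 4 * m + 3328 * (M * q) := by ring
      _ ≤ 4 * m + 3328 * (16 * m) := by gcongr
      _ ≤ 60000 * m := by omega

/-- For all admissible parameters there is a tester. -/
theorem exists_testsCloseness_of_le {k n m : ℕ} {ε : ℝ} (hε0 : 0 < ε) (hε1 : ε ≤ 1)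
    (hkm : Real.logb 2 k ≤ m) (hεm : Real.logb 2 (1 / ε) ≤ m)
    (hmk : (m : ℝ) ≤ k * Real.logb 2 n)
    (hn : 10 ^ 4 * max ((k : ℝ) * √(Real.logb 2 n) / (ε ^ 2 * √(m : ℝ)))
      ((k : ℝ) ^ (2 / 3 : ℝ) / ε ^ (4 / 3 : ℝ)) ≤ n) :
    ∃ A : StreamAlg k (60000 * m), A.TestsCloseness n ε := by
  rcases le_or_gt k 1 with hk | hk
  · exact exists_testsCloseness_of_le_one hk _ n hε0
  have hk0 : (0 : ℝ) < k := by exact_mod_cast (by omega : 0 < k)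
  have hkm' : k ≤ 2 ^ m := by
    rw [Real.logb_le_iff_le_rpow one_lt_two hk0, Real.rpow_natCast] at hkm
    exact_mod_cast hkm
  have hm : 0 < m := by
    rcases Nat.eq_zero_or_pos m with rfl | h
    · simp at hkm'; omega
    · exact h
  have hm' : (0 : ℝ) < m := by exact_mod_cast hm
  have hεm' : 1 ≤ ε * 2 ^ m := by
    rw [Real.logb_le_iff_le_rpow one_lt_two (by positivity), Real.rpow_natCast,
      div_le_iff₀ hε0] at hεm
    linarith
  rcases lt_or_ge (2 ^ (15 * m)) n with hlong | hshort
  · exact exists_testsCloseness_of_long_stream (by omega) hm hε0 hε1 hkm' hεm' hlong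
  have hL0 : 0 ≤ Real.logb 2 n := by
    by_contra hneg
    have := mul_neg_of_pos_of_neg hk0 (not_le.1 hneg)
    linarith
  refine exists_testsCloseness_of_short_stream (by omega) hm hε0 hε1 hkm' hshort hmk ?_ ?_
  · have h := (mul_le_mul_of_nonneg_left (le_max_left _ _) (by positivity)).trans hn
    rw [← mul_div_assoc, div_le_iff₀ (by positivity)] at h
    have h' := pow_le_pow_left₀ (by positivity) h 2
    simp only [mul_pow, Real.sq_sqrt hL0, Real.sq_sqrt hm'.le] at h'
    linarith
  · have h := (mul_le_mul_of_nonneg_left (le_max_right _ _) (by positivity)).trans hn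
    rw [← mul_div_assoc, div_le_iff₀ (by positivity)] at h
    have h' := pow_le_pow_left₀ (by positivity) h 3
    have e1 : ((k : ℝ) ^ (2 / 3 : ℝ)) ^ 3 = k ^ 2 := by
      rw [← Real.rpow_natCast, ← Real.rpow_mul hk0.le, ← Real.rpow_natCast]
      norm_num
    have e2 : (ε ^ (4 / 3 : ℝ)) ^ 3 = ε ^ 4 := by
      rw [← Real.rpow_natCast, ← Real.rpow_mul hε0.le, ← Real.rpow_natCast]
      norm_num
    simp only [mul_pow, e1, e2] at h'
    linarith

theorem theorem3 :
    ∃ (C : ℝ) (c : ℕ) (A : (k : ℕ) → (ε : ℝ) → (n m : ℕ) → StreamAlg k (c * m)),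
      0 < C ∧
      ∀ (k : ℕ) (ε : ℝ) (n m : ℕ),
        0 < ε → ε ≤ 1 →
        Real.logb 2 k ≤ m →
        Real.logb 2 (1 / ε) ≤ m →
        (m : ℝ) ≤ k * Real.logb 2 n →
        C * max ((k : ℝ) * √(Real.logb 2 n) / (ε ^ 2 * √(m : ℝ)))
            ((k : ℝ) ^ (2 / 3 : ℝ) / ε ^ (4 / 3 : ℝ)) ≤ n →
        (A k ε n m).TestsCloseness n ε := by
  classical
  -- for parameters that are not admissible any algorithm will do
  refine ⟨10 ^ 4, 60000, fun k ε n m =>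
    if h : ∃ A : StreamAlg k (60000 * m), A.TestsCloseness n ε then h.choose
    else ⟨PMF.pure fun _ => false, fun s _ => PMF.pure s, fun _ => true⟩, by positivity,
    fun k ε n m hε0 hε1 hkm hεm hmk hn => ?_⟩
  have h := exists_testsCloseness_of_le hε0 hε1 hkm hεm hmk hn
  simp only [dif_pos h]
  exact h.choose_spec
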